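/- A \emph{weight function} is a continuous increasing (i.e. non-decreasing) function $\omega:[0,\infty)\to[0,\infty)$ with $\omega\equiv 0$ on $[0,1]$ such that, as $t\to\infty$, $(\alpha)$ $\omega(2t)=O(\omega(t))$, $(\beta)$ $\omega(t)=O(t)$, $(\gamma)$ $\log t=o(\omega(t))$, and such that $(\delta)$ $\psi(x):=\omega(e^x)$ is convex on $[0,\infty)$. Put $\psi^*(y):=\sup_{x\ge 0}(xy-\psi(x))$ for $y\ge 0$. For $n\in\mathbb{Z}_+=\{1,2,\ldots\}$ let $\mathcal{D}_{L^1,\omega,n}(\mathbb{R}^d)$ be the normed space of all $\varphi\in C^\infty(\mathbb{R}^d)$ (complex-valued) with $\varphi^{(\alpha)}\in L^1(\mathbb{R}^d)$ for all $\alpha\in\mathbb{N}^d$ and $$\|\varphi\|_{\mathcal{D}_{L^1,\omega,n}}:=\sup_{\alpha\in\mathbb{N}^d}\|\varphi^{(\alpha)}\|_{L^1}\exp\Bigl(-\tfrac1n\psi^*(n|\alpha|)\Bigr)<\infty,$$ let $\mathcal{D}_{L^1,\{\omega\}}(\mathbb{R}^d):=\varinjlim_{n}\mathcal{D}_{L^1,\omega,n}(\mathbb{R}^d)$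 (locally convex inductive limit), and let $\mathcal{B}'_{\{\omega\}}(\mathbb{R}^d)$ be its topological dual, endowed with the strong topology (uniform convergence on bounded sets). \textbf{Theorem.} For every $d$ and every weight function $\omega$ (quasianalytic or not), $\mathcal{B}'_{\{\omega\}}(\mathbb{R}^d)$ is a Fréchet space and satisfies $(\underline{DN})$: for every fundamental increasing sequence of seminorms $(\|\cdot\|_n)_{n\in\mathbb{N}}$ of $X=\mathcal{B}'_{\{\omega\}}(\mathbb{R}^d)$, $$\exists n\ \forall m\ge n\ \exists\theta\in(0,1)\ \exists k\ge m\ \exists C>0\ \forall x\in X:\quad \|x\|_m\le C\,\|x\|_n^{\theta}\,\|x\|_k^{1-\theta}.$$ -/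

import Mathlib

open Set Filter MeasureTheory
open scoped ENNReal Topology

/-- A weight function `ω : [0,∞) → [0,∞)`: continuous, increasing (in the wide sense), zero on
`[0,1]`, with `(α) ω(2t) = O(ω(t))`, `(β) ω(t) = O(t)`, `(γ) log t = o(ω(t))` as `t → ∞`, and
`(δ) x ↦ ω(eˣ)` convex on `[0,∞)`. Only the values of `toFun` on `[0,∞)` matter. -/
structure WeightFunction where
  toFun : ℝ → ℝ
  continuousOn : ContinuousOn toFun (Ici 0)
  monotoneOn : MonotoneOn toFun (Ici 0)
  nonneg : ∀ t, 0 ≤ t → 0 ≤ toFun t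
  eq_zero : ∀ t ∈ Icc (0 : ℝ) 1, toFun t = 0
  alpha : (fun t : ℝ => toFun (2 * t)) =O[atTop] toFun
  beta : toFun =O[atTop] (fun t : ℝ => t)
  gamma : Real.log =o[atTop] toFun
  delta : ConvexOn ℝ (Ici 0) (fun x : ℝ => toFun (Real.exp x))

namespace WeightFunction

/-- `ψ(x) = ω(eˣ)`. -/
noncomputable def psi (ω : WeightFunction) (x : ℝ) : ℝ := ω.toFun (Real.exp x)

/-- The Young conjugate `ψ*(y) = sup_{x ≥ 0} (x y - ψ(x))`. -/
noncomputable def psiStar (ω : WeightFunction) (y : ℝ) : ℝ :=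
  ⨆ x : Ici (0 : ℝ), ((x : ℝ) * y - ω.psi x)

theorem psi_nonneg (ω : WeightFunction) (x : ℝ) : 0 ≤ ω.psi x :=
  ω.nonneg _ (Real.exp_pos x).le

/-- The supremum defining `ψ*(y)` is finite, by `(γ)`. -/
theorem bddAbove_psiStar (ω : WeightFunction) {y : ℝ} (hy : 0 ≤ y) :
    BddAbove (range fun x : Ici (0 : ℝ) => (x : ℝ) * y - ω.psi x) := by
  have hc : (0 : ℝ) < 1 / (y + 1) := by positivity
  have h := (ω.gamma.comp_tendsto Real.tendsto_exp_atTop).def hc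
  obtain ⟨A, hA⟩ := eventually_atTop.1 h
  refine ⟨|A| * y, ?_⟩
  rintro _ ⟨⟨x, hx⟩, rfl⟩
  have hx0 : (0 : ℝ) ≤ x := hx
  have hpsi := ω.psi_nonneg x
  change x * y - ω.psi x ≤ |A| * y
  rcases le_total x |A| with hxA | hxA
  · nlinarith
  · have h1 := hA x ((le_abs_self A).trans hxA)
    simp only [Function.comp_apply, Real.log_exp, Real.norm_eq_abs, abs_of_nonneg hx0] at h1
    rw [abs_of_nonneg (ω.nonneg _ (Real.exp_pos x).le)] at h1
    have h2 : x * (y + 1) ≤ ω.psi x := by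
      have := mul_le_mul_of_nonneg_right h1 (by positivity : 0 ≤ y + 1)
      have e : 1 / (y + 1) * ω.toFun (Real.exp x) * (y + 1) = ω.toFun (Real.exp x) := by
        field_simp
      rw [e] at this
      exact this
    have : 0 ≤ |A| * y := by positivity
    nlinarith

/-- The exponents `ψ*(n y) / n` increase with `n`. -/
theorem psiStar_div_mono (ω : WeightFunction) {m n : ℕ} (hm : 1 ≤ m) (hmn : m ≤ n) {y : ℝ}
    (hy : 0 ≤ y) :
    1 / (m : ℝ) * ω.psiStar (m * y) ≤ 1 / (n : ℝ) * ω.psiStar (n * y) := by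
  have hm0 : (0 : ℝ) < m := by exact_mod_cast hm
  have hn0 : (0 : ℝ) < n := by exact_mod_cast hm.trans hmn
  have hmn' : (m : ℝ) ≤ n := by exact_mod_cast hmn
  have : Nonempty (Ici (0 : ℝ)) := ⟨⟨0, self_mem_Ici⟩⟩
  have key : ω.psiStar (m * y) ≤ (m : ℝ) / n * ω.psiStar (n * y) := by
    refine ciSup_le fun x => ?_
    have h1 := le_ciSup (ω.bddAbove_psiStar (by positivity : 0 ≤ (n : ℝ) * y)) x
    have h2 : (m : ℝ) / n * ((x : ℝ) * (n * y) - ω.psi x) ≤ m / n * ω.psiStar (n * y) :=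
      mul_le_mul_of_nonneg_left h1 (by positivity)
    have h3 : (m : ℝ) / n * ω.psi x ≤ 1 * ω.psi x :=
      mul_le_mul_of_nonneg_right ((div_le_one hn0).2 hmn') (ω.psi_nonneg x)
    have h4 : (m : ℝ) / n * ((x : ℝ) * (n * y) - ω.psi x)
        = (x : ℝ) * (m * y) - m / n * ω.psi x := by
      field_simp
    linarith
  calc 1 / (m : ℝ) * ω.psiStar (m * y) ≤ 1 / (m : ℝ) * ((m : ℝ) / n * ω.psiStar (n * y)) :=
        mul_le_mul_of_nonneg_left key (by positivity)
    _ = 1 / (n : ℝ) * ω.psiStar (n * y) := by field_simp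

end WeightFunction

section Derivatives

variable {d : ℕ}

/-- The partial derivative `∂f/∂xᵢ`. -/
noncomputable def partialDeriv (i : Fin d) (f : EuclideanSpace ℝ (Fin d) → ℂ) :
    EuclideanSpace ℝ (Fin d) → ℂ :=
  fun x => fderiv ℝ f x (EuclideanSpace.single i 1)

/-- The partial derivative `f^{(α)} = ∂₁^{α₁} ⋯ ∂_d^{α_d} f` for a multi-index `α ∈ ℕᵈ`. -/
noncomputable def multiDeriv (α : Fin d → ℕ) (f : EuclideanSpace ℝ (Fin d) → ℂ) :
    EuclideanSpace ℝ (Fin d) → ℂ :=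
  (List.finRange d).foldr (fun i g => (partialDeriv i)^[α i] g) f

theorem ContDiff.partialDeriv {f : EuclideanSpace ℝ (Fin d) → ℂ} (hf : ContDiff ℝ (⊤ : ℕ∞) f)
    (i : Fin d) : ContDiff ℝ (⊤ : ℕ∞) (partialDeriv i f) :=
  (hf.fderiv_right (m := ((⊤ : ℕ∞) : WithTop ℕ∞)) (by simp)).clm_apply contDiff_const

theorem partialDeriv_add {f g : EuclideanSpace ℝ (Fin d) → ℂ} (hf : ContDiff ℝ (⊤ : ℕ∞) f)
    (hg : ContDiff ℝ (⊤ : ℕ∞) g) (i : Fin d) :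
    partialDeriv i (f + g) = partialDeriv i f + partialDeriv i g := by
  funext x
  simp only [partialDeriv, Pi.add_apply]
  rw [fderiv_add (hf.differentiable (by simp) x) (hg.differentiable (by simp) x)]
  simp

theorem partialDeriv_smul {f : EuclideanSpace ℝ (Fin d) → ℂ} (hf : ContDiff ℝ (⊤ : ℕ∞) f) (c : ℂ)
    (i : Fin d) : partialDeriv i (c • f) = c • partialDeriv i f := by
  funext x
  simp only [partialDeriv, Pi.smul_apply]
  rw [fderiv_const_smul (hf.differentiable (by simp) x)]
  simp

theorem ContDiff.iterate_partialDeriv {f : EuclideanSpace ℝ (Fin d) → ℂ} (hf : ContDiff ℝ (⊤ : ℕ∞) f)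
    (i : Fin d) (k : ℕ) : ContDiff ℝ (⊤ : ℕ∞) ((_root_.partialDeriv i)^[k] f) := by
  induction k with
  | zero => exact hf
  | succ k ih => rw [Function.iterate_succ_apply']; exact ih.partialDeriv i

theorem iterate_partialDeriv_add {f g : EuclideanSpace ℝ (Fin d) → ℂ} (hf : ContDiff ℝ (⊤ : ℕ∞) f)
    (hg : ContDiff ℝ (⊤ : ℕ∞) g) (i : Fin d) (k : ℕ) :
    (partialDeriv i)^[k] (f + g) = (partialDeriv i)^[k] f + (partialDeriv i)^[k] g := by
  induction k with
  | zero => rfl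
  | succ k ih =>
    simp only [Function.iterate_succ_apply', ih]
    exact partialDeriv_add (hf.iterate_partialDeriv i k) (hg.iterate_partialDeriv i k) i

theorem iterate_partialDeriv_smul {f : EuclideanSpace ℝ (Fin d) → ℂ} (hf : ContDiff ℝ (⊤ : ℕ∞) f)
    (c : ℂ) (i : Fin d) (k : ℕ) :
    (partialDeriv i)^[k] (c • f) = c • (partialDeriv i)^[k] f := by
  induction k with
  | zero => rfl
  | succ k ih =>
    simp only [Function.iterate_succ_apply', ih]
    exact partialDeriv_smul (hf.iterate_partialDeriv i k) c i

theorem ContDiff.multiDeriv {f : EuclideanSpace ℝ (Fin d) → ℂ} (hf : ContDiff ℝ (⊤ : ℕ∞) f)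
    (α : Fin d → ℕ) : ContDiff ℝ (⊤ : ℕ∞) (multiDeriv α f) := by
  unfold _root_.multiDeriv
  induction List.finRange d with
  | nil => exact hf
  | cons i l ih => exact ih.iterate_partialDeriv i (α i)

theorem multiDeriv_add {f g : EuclideanSpace ℝ (Fin d) → ℂ} (hf : ContDiff ℝ (⊤ : ℕ∞) f)
    (hg : ContDiff ℝ (⊤ : ℕ∞) g) (α : Fin d → ℕ) :
    multiDeriv α (f + g) = multiDeriv α f + multiDeriv α g := by
  have aux : ∀ {h : EuclideanSpace ℝ (Fin d) → ℂ}, ContDiff ℝ (⊤ : ℕ∞) h → ∀ l : List (Fin d),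
      ContDiff ℝ (⊤ : ℕ∞) (l.foldr (fun i g => (partialDeriv i)^[α i] g) h) := by
    intro h hh l
    induction l with
    | nil => exact hh
    | cons i l ih => exact ih.iterate_partialDeriv i (α i)
  unfold multiDeriv
  induction List.finRange d with
  | nil => rfl
  | cons i l ih =>
    simp only [List.foldr_cons, ih]
    exact iterate_partialDeriv_add (aux hf l) (aux hg l) i (α i)

theorem multiDeriv_smul {f : EuclideanSpace ℝ (Fin d) → ℂ} (hf : ContDiff ℝ (⊤ : ℕ∞) f) (c : ℂ)
    (α : Fin d → ℕ) : multiDeriv α (c • f) = c • multiDeriv α f := by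
  have aux : ∀ l : List (Fin d),
      ContDiff ℝ (⊤ : ℕ∞) (l.foldr (fun i g => (partialDeriv i)^[α i] g) f) := by
    intro l
    induction l with
    | nil => exact hf
    | cons i l ih => exact ih.iterate_partialDeriv i (α i)
  unfold multiDeriv
  induction List.finRange d with
  | nil => rfl
  | cons i l ih =>
    simp only [List.foldr_cons, ih]
    exact iterate_partialDeriv_smul (aux l) c i (α i)

theorem multiDeriv_zero_fun (α : Fin d → ℕ) :
    multiDeriv α (0 : EuclideanSpace ℝ (Fin d) → ℂ) = 0 := by
  have h : ContDiff ℝ (⊤ : ℕ∞) (0 : EuclideanSpace ℝ (Fin d) → ℂ) := contDiff_const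
  simpa using multiDeriv_smul h 0 α

end Derivatives

section TestSpace

/-- `‖φ‖_{D_{L¹,ω,n}} = sup_α ‖φ^{(α)}‖_{L¹} exp(-ψ*(n|α|)/n)`, with values in `[0,∞]`. -/
noncomputable def DL1norm (d : ℕ) (ω : WeightFunction) (n : ℕ)
    (φ : EuclideanSpace ℝ (Fin d) → ℂ) : ℝ≥0∞ :=
  ⨆ α : Fin d → ℕ, eLpNorm (multiDeriv α φ) 1 volume *
    ENNReal.ofReal (Real.exp (-(1 / (n : ℝ) * ω.psiStar (n * ((∑ i, α i : ℕ) : ℝ)))))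

theorem DL1norm_zero (d : ℕ) (ω : WeightFunction) (n : ℕ) : DL1norm d ω n 0 = 0 := by
  simp [DL1norm, multiDeriv_zero_fun]

theorem DL1norm_add_le {d : ℕ} (ω : WeightFunction) (n : ℕ)
    {φ χ : EuclideanSpace ℝ (Fin d) → ℂ} (hφ : ContDiff ℝ (⊤ : ℕ∞) φ) (hχ : ContDiff ℝ (⊤ : ℕ∞) χ) :
    DL1norm d ω n (φ + χ) ≤ DL1norm d ω n φ + DL1norm d ω n χ := by
  refine iSup_le fun α => ?_
  rw [multiDeriv_add hφ hχ]
  have h := eLpNorm_add_le (μ := volume) (p := 1)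
    (hφ.multiDeriv α).continuous.aestronglyMeasurable
    (hχ.multiDeriv α).continuous.aestronglyMeasurable le_rfl
  refine (mul_le_mul_left h _).trans ?_
  rw [add_mul]
  exact add_le_add (le_iSup (fun α : Fin d → ℕ => eLpNorm (multiDeriv α φ) 1 volume *
    ENNReal.ofReal (Real.exp (-(1 / (n : ℝ) * ω.psiStar (n * ((∑ i, α i : ℕ) : ℝ)))))) α)
    (le_iSup (fun α : Fin d → ℕ => eLpNorm (multiDeriv α χ) 1 volume *
    ENNReal.ofReal (Real.exp (-(1 / (n : ℝ) * ω.psiStar (n * ((∑ i, α i : ℕ) : ℝ)))))) α)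

theorem DL1norm_smul {d : ℕ} (ω : WeightFunction) (n : ℕ)
    {φ : EuclideanSpace ℝ (Fin d) → ℂ} (hφ : ContDiff ℝ (⊤ : ℕ∞) φ) (c : ℂ) :
    DL1norm d ω n (c • φ) = ‖c‖ₑ * DL1norm d ω n φ := by
  unfold DL1norm
  rw [ENNReal.mul_iSup]
  refine iSup_congr fun α => ?_
  rw [multiDeriv_smul hφ, eLpNorm_const_smul, mul_assoc]

theorem DL1norm_anti {d : ℕ} (ω : WeightFunction) {m n : ℕ} (hm : 1 ≤ m) (hmn : m ≤ n)
    (φ : EuclideanSpace ℝ (Fin d) → ℂ) : DL1norm d ω n φ ≤ DL1norm d ω m φ := by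
  refine iSup_mono fun α => ?_
  gcongr _ * ENNReal.ofReal (Real.exp (-?_))
  exact ω.psiStar_div_mono hm hmn (Nat.cast_nonneg _)

/-- The space `D_{L¹,ω,n}(ℝᵈ)` of all `φ ∈ C^∞(ℝᵈ)` such that `φ^{(α)} ∈ L¹` for all `α` and
`‖φ‖_{D_{L¹,ω,n}} < ∞`; meant for `n ≥ 1`. -/
noncomputable def DL1Step (d : ℕ) (ω : WeightFunction) (n : ℕ) :
    Submodule ℂ (EuclideanSpace ℝ (Fin d) → ℂ) where
  carrier := {φ | ContDiff ℝ (⊤ : ℕ∞) φ ∧ (∀ α : Fin d → ℕ, Integrable (multiDeriv α φ)) ∧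
    DL1norm d ω n φ < ∞}
  zero_mem' := by
    refine ⟨contDiff_const, fun α => ?_, ?_⟩
    · rw [multiDeriv_zero_fun]; exact integrable_zero _ _ _
    · rw [DL1norm_zero]; exact ENNReal.zero_lt_top
  add_mem' := by
    rintro φ χ ⟨h1, h2, h3⟩ ⟨k1, k2, k3⟩
    refine ⟨h1.add k1, fun α => ?_, ?_⟩
    · rw [multiDeriv_add h1 k1]; exact (h2 α).add (k2 α)
    · exact (DL1norm_add_le ω n h1 k1).trans_lt (ENNReal.add_lt_top.2 ⟨h3, k3⟩)
  smul_mem' := by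
    rintro c φ ⟨h1, h2, h3⟩
    refine ⟨contDiff_const.smul h1, fun α => ?_, ?_⟩
    · rw [multiDeriv_smul h1]; exact (h2 α).smul c
    · rw [DL1norm_smul ω n h1]; exact ENNReal.mul_lt_top enorm_lt_top h3

theorem DL1Step_mono (d : ℕ) (ω : WeightFunction) {m n : ℕ} (hm : 1 ≤ m) (hmn : m ≤ n) :
    DL1Step d ω m ≤ DL1Step d ω n :=
  fun φ h => ⟨h.1, h.2.1, (DL1norm_anti ω hm hmn φ).trans_lt h.2.2⟩

/-- The vector space `⋃_{n ≥ 1} D_{L¹,ω,n}(ℝᵈ)`. -/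
noncomputable def DL1Union (d : ℕ) (ω : WeightFunction) :
    Submodule ℂ (EuclideanSpace ℝ (Fin d) → ℂ) where
  carrier := {φ | ∃ n : ℕ, 1 ≤ n ∧ φ ∈ DL1Step d ω n}
  zero_mem' := ⟨1, le_rfl, (DL1Step d ω 1).zero_mem⟩
  add_mem' := by
    rintro φ χ ⟨m, hm, hφ⟩ ⟨n, hn, hχ⟩
    exact ⟨max m n, hm.trans (le_max_left m n), (DL1Step d ω _).add_mem
      (DL1Step_mono d ω hm (le_max_left m n) hφ) (DL1Step_mono d ω hn (le_max_right m n) hχ)⟩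
  smul_mem' := by
    rintro c φ ⟨m, hm, hφ⟩
    exact ⟨m, hm, (DL1Step d ω m).smul_mem c hφ⟩

/-- The space `D_{L¹,{ω}}(ℝᵈ) = ind_n D_{L¹,ω,n}(ℝᵈ)`. It is a type of its own, so that it does not
inherit the topology of pointwise convergence from the space of all functions. -/
def DL1 (d : ℕ) (ω : WeightFunction) : Type := ↥(DL1Union d ω)

noncomputable instance (d : ℕ) (ω : WeightFunction) : AddCommGroup (DL1 d ω) :=
  inferInstanceAs (AddCommGroup ↥(DL1Union d ω))

noncomputable instance (d : ℕ) (ω : WeightFunction) : Module ℂ (DL1 d ω) :=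
  inferInstanceAs (Module ℂ ↥(DL1Union d ω))

/-- The function underlying an element of `D_{L¹,{ω}}(ℝᵈ)`. -/
def DL1.toFun {d : ℕ} {ω : WeightFunction} (φ : DL1 d ω) : EuclideanSpace ℝ (Fin d) → ℂ :=
  Subtype.val φ

/-- The seminorms on `D_{L¹,{ω}}(ℝᵈ)` whose restriction to the normed space `D_{L¹,ω,n}(ℝᵈ)` is
continuous for every `n ≥ 1`. -/
def DL1Seminorms (d : ℕ) (ω : WeightFunction) : Set (Seminorm ℂ (DL1 d ω)) :=
  {p | ∀ n : ℕ, 1 ≤ n → ∃ C : ℝ, ∀ φ : DL1 d ω, φ.toFun ∈ DL1Step d ω n →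
    p φ ≤ C * (DL1norm d ω n φ.toFun).toReal}

instance (d : ℕ) (ω : WeightFunction) : Nonempty (DL1Seminorms d ω) :=
  ⟨⟨0, fun _ _ => ⟨0, fun φ _ => by simp⟩⟩⟩

/-- The locally convex inductive limit topology of `D_{L¹,{ω}}(ℝᵈ)`, that is, the finest locally
convex topology for which all inclusions `D_{L¹,ω,n}(ℝᵈ) → D_{L¹,{ω}}(ℝᵈ)` are continuous: it is
generated by all seminorms with continuous restrictions to the steps. -/
noncomputable instance (d : ℕ) (ω : WeightFunction) : TopologicalSpace (DL1 d ω) :=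
  SeminormFamily.moduleFilterBasis (𝕜 := ℂ) (F := DL1 d ω)
    (fun p : DL1Seminorms d ω => p.1) |>.topology

theorem DL1.withSeminorms (d : ℕ) (ω : WeightFunction) :
    WithSeminorms (𝕜 := ℂ) (E := DL1 d ω) (fun p : DL1Seminorms d ω => p.1) := ⟨rfl⟩

instance (d : ℕ) (ω : WeightFunction) : IsTopologicalAddGroup (DL1 d ω) :=
  (DL1.withSeminorms d ω).topologicalAddGroup

instance (d : ℕ) (ω : WeightFunction) : ContinuousSMul ℂ (DL1 d ω) :=
  (DL1.withSeminorms d ω).continuousSMul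

/-- The space `B'_{{ω}}(ℝᵈ)` of bounded infrahyperfunctions (`ω` quasianalytic) or bounded
ultradistributions (`ω` non-quasianalytic) of class `{ω}`: the topological dual of
`D_{L¹,{ω}}(ℝᵈ)`, with the strong topology (uniform convergence on bounded sets). -/
abbrev BoundedUltradistribution (d : ℕ) (ω : WeightFunction) : Type :=
  StrongDual ℂ (DL1 d ω)

end TestSpace

section Frechet

/-- `p` is a fundamental increasing sequence of seminorms of `X`: it is increasing and generates
the topology. -/
def IsFundamentalSequence {X : Type*} [AddCommGroup X] [Module ℂ X] [TopologicalSpace X]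
    (p : ℕ → Seminorm ℂ X) : Prop :=
  Monotone p ∧ WithSeminorms p

/-- `X` is a Fréchet space: Hausdorff, complete, and with topology given by an increasing sequence
of seminorms. -/
structure IsFrechetSpace (X : Type*) [AddCommGroup X] [Module ℂ X] [UniformSpace X]
    [IsUniformAddGroup X] : Prop where
  t2 : T2Space X
  complete : CompleteSpace X
  exists_seminorms : ∃ p : ℕ → Seminorm ℂ X, IsFundamentalSequence p

/-- The condition `(DN)` with underline for a Fréchet space `X`, required for every fundamental
increasing sequence of seminorms of `X`:
`∃ n ∀ m ≥ n ∃ θ ∈ (0,1) ∃ k ≥ m ∃ C > 0 ∀ x, ‖x‖_m ≤ C ‖x‖_n^θ ‖x‖_k^{1-θ}`. -/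
def SatisfiesUnderlineDN (X : Type*) [AddCommGroup X] [Module ℂ X] [UniformSpace X]
    [IsUniformAddGroup X] : Prop :=
  ∀ p : ℕ → Seminorm ℂ X, IsFundamentalSequence p →
    ∃ n : ℕ, ∀ m : ℕ, n ≤ m → ∃ θ ∈ Ioo (0 : ℝ) 1, ∃ k : ℕ, m ≤ k ∧ ∃ C : ℝ, 0 < C ∧
      ∀ x : X, p m x ≤ C * p n x ^ θ * p k x ^ (1 - θ)

end Frechet

/-! ### Polar seminorms on the strong dual; the Fréchet property. -/

section DualSeminorms

open Bornology

variable {E : Type*} [AddCommGroup E] [Module ℂ E] [TopologicalSpace E]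

/-! Let `B n` be the unit ball of the step of index `n + 1`. These balls are bounded, increase,
absorb every element, and any seminorm bounded on each of them is continuous. These facts alone make
the strong dual a Fréchet space whose topology is given by the suprema over the `B n`
(`exists_dualSeminorm_le`, `completeSpace_strongDual`); regularity of the inductive limit is not
needed.

By duality, (DN) follows if each `f` in `B m` splits, for every large `R`, as `f₁ + f₂` with `f₁ ∈ C
e^{aR} B 0` and `f₂ ∈ C e^{-bR} B k`, where `k, a, b, C` depend only on `m`. Optimizing `R` then
gives the interpolation inequality with `θ = b/(a+b)` (`le_rpow_mul_rpow_of_forall_exp`).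

The splitting (`exists_decomposition`) uses `g_ρ(x) = ρ^d g(ρx)`, where `g` is a Schwartz function
of integral one with compactly supported Fourier transform. Put `T f = f - f ⋆ g_ρ`, `f₂ = T^N f`
and `f₁ = f - f₂`. Each factor `T` trades one derivative for a factor `O(1/ρ)`, while Bernstein's
inequality bounds the derivatives of `f₁` of order `j` by `G^N (Aρ)^j`. The kernel is localized on
the Fourier side, so non-quasianalyticity plays no role.

For the choice of `ρ` and `N` (`WeightFunction.exists_scale_and_order`), take `ψ(X) = R`, `ρ`
comparable to `e^X`, and `N` the integer part of `y/(2m)` for a subgradient `y` of `ψ` at `X`.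
Condition (α) gives `y = O(R)` and `(Aρ)^j ≤ e^{O(R+1) + ψ*(j)}`, hence the bound for `f₁`. For
`f₂`, convexity of `ψ*` separates `j` from `N` at the price of passing from `m` to `2m`; the `N`
part combines with `ρ^{-N}` to `e^{X - R/(2m)}` up to constants, and (γ) makes `X ≤ R/(4m) + O(1)`.
-/

theorem Bornology.IsVonNBounded.bddAbove_norm_apply {B : Set E} (hB : IsVonNBounded ℂ B)
    (x : StrongDual ℂ E) : BddAbove (range fun φ : B => ‖x φ‖) := by
  obtain ⟨C, hC⟩ := isBounded_iff_forall_norm_le.1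
    ((NormedSpace.isVonNBounded_iff ℂ).1 (hB.image x))
  exact ⟨C, by rintro _ ⟨φ, rfl⟩; exact hC _ (mem_image_of_mem _ φ.2)⟩

/-- The seminorm `x ↦ sup_{φ ∈ B} |x φ|` on the dual space, for a bounded set `B`. -/
noncomputable def dualSeminorm (B : Set E) (hB : IsVonNBounded ℂ B) :
    Seminorm ℂ (StrongDual ℂ E) :=
  Seminorm.of (fun x => ⨆ φ : B, ‖x φ‖)
    (fun x y => by
      rcases isEmpty_or_nonempty B with h | h
      · simp
      · refine ciSup_le fun φ => (norm_add_le _ _).trans (add_le_add ?_ ?_)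
        · exact le_ciSup (hB.bddAbove_norm_apply x) φ
        · exact le_ciSup (hB.bddAbove_norm_apply y) φ)
    (fun c x => by
      simp only [smul_apply, norm_smul]
      rw [Real.mul_iSup_of_nonneg (norm_nonneg c)])

theorem norm_apply_le_dualSeminorm {B : Set E} (hB : IsVonNBounded ℂ B) (x : StrongDual ℂ E)
    {φ : E} (hφ : φ ∈ B) : ‖x φ‖ ≤ dualSeminorm B hB x :=
  le_ciSup (hB.bddAbove_norm_apply x) ⟨φ, hφ⟩

theorem dualSeminorm_le {B : Set E} (hB : IsVonNBounded ℂ B) {x : StrongDual ℂ E} {C : ℝ}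
    (hC : 0 ≤ C) (h : ∀ φ ∈ B, ‖x φ‖ ≤ C) : dualSeminorm B hB x ≤ C :=
  Real.iSup_le (fun φ => h φ φ.2) hC

theorem dualSeminorm_mono {B S : Set E} (hB : IsVonNBounded ℂ B) (hS : IsVonNBounded ℂ S)
    (h : B ⊆ S) (x : StrongDual ℂ E) : dualSeminorm B hB x ≤ dualSeminorm S hS x :=
  dualSeminorm_le hB (apply_nonneg _ _) fun _ hφ => norm_apply_le_dualSeminorm hS x (h hφ)

/-- A sequence of bounded sets such that every seminorm bounded on each of them is continuous
dominates all bounded sets, as far as the polar seminorms on the dual are concerned. -/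
theorem exists_dualSeminorm_le {B : ℕ → Set E} (hB : ∀ n, IsVonNBounded ℂ (B n))
    (hmono : Monotone B) (habs : ∀ φ, ∃ n, ∃ c : ℂ, ∃ χ ∈ B n, φ = c • χ)
    (hcont : ∀ p : Seminorm ℂ E, (∀ n, BddAbove (p '' B n)) → Continuous p)
    {S : Set E} (hS : IsVonNBounded ℂ S) :
    ∃ n : ℕ, ∀ x : StrongDual ℂ E, dualSeminorm S hS x ≤ n * dualSeminorm (B n) (hB n) x := by
  -- Otherwise there are functionals `y n`, at most one on `B n` but exceeding `n` somewhere on `S`.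
  -- Their pointwise supremum is a continuous seminorm unbounded on `S`, which contradicts
  -- boundedness of `S`.
  by_contra! hcon
  choose x hx using hcon
  have hex : ∀ n : ℕ, ∃ y : StrongDual ℂ E, dualSeminorm (B n) (hB n) y ≤ 1 ∧
      (n : ℝ) < dualSeminorm S hS y := by
    intro n
    set a := dualSeminorm (B n) (hB n) (x n) with ha
    set b := dualSeminorm S hS (x n) with hb
    have ha0 : 0 ≤ a := apply_nonneg _ _
    have hxn : (n : ℝ) * a < b := hx n
    have hb0 : 0 < b := lt_of_le_of_lt (by positivity) hxn
    -- A functional vanishing on `B n` cannot be normalized there, but may be scaled freely to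
    -- exceed `n` on `S`.
    rcases eq_or_lt_of_le ha0 with h0 | h0
    · refine ⟨(((n + 1) / b : ℝ) : ℂ) • x n, ?_, ?_⟩
      · rw [map_smul_eq_mul, ← ha, ← h0]; simp
      · rw [map_smul_eq_mul, ← hb, Complex.norm_real, Real.norm_eq_abs,
          abs_of_nonneg (by positivity), div_mul_cancel₀ _ hb0.ne']
        linarith
    · refine ⟨((1 / a : ℝ) : ℂ) • x n, ?_, ?_⟩
      · rw [map_smul_eq_mul, ← ha, Complex.norm_real, Real.norm_eq_abs,
          abs_of_nonneg (by positivity), div_mul_cancel₀ _ h0.ne']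
      · rw [map_smul_eq_mul, ← hb, Complex.norm_real, Real.norm_eq_abs,
          abs_of_nonneg (by positivity), div_mul_eq_mul_div, one_mul, lt_div_iff₀ h0]
        exact hxn
  choose y hy1 hy2 using hex
  -- For `k ≥ n` the bound is one, because `B n ⊆ B k`; the finitely many `k < n` are absorbed by
  -- the sum.
  have hstep : ∀ n, ∃ C : ℝ, 0 ≤ C ∧ ∀ k, ∀ φ ∈ B n, ‖y k φ‖ ≤ C := by
    intro n
    refine ⟨1 + ∑ k ∈ Finset.range n, dualSeminorm (B n) (hB n) (y k),
      add_nonneg zero_le_one (Finset.sum_nonneg fun _ _ => apply_nonneg _ _), fun k φ hφ => ?_⟩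
    have hs : 0 ≤ ∑ k ∈ Finset.range n, dualSeminorm (B n) (hB n) (y k) :=
      Finset.sum_nonneg fun _ _ => apply_nonneg _ _
    rcases lt_or_ge k n with hk | hk
    · have h1 := norm_apply_le_dualSeminorm (hB n) (y k) hφ
      have h2 := Finset.single_le_sum (f := fun k => dualSeminorm (B n) (hB n) (y k))
        (fun _ _ => apply_nonneg _ _) (Finset.mem_range.2 hk)
      linarith
    · have h1 := (norm_apply_le_dualSeminorm (hB k) (y k) (hmono hk hφ)).trans (hy1 k)
      linarith
  have hbdd : ∀ φ, BddAbove (range fun k => ‖y k φ‖) := by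
    intro φ
    obtain ⟨n, c, χ, hχ, rfl⟩ := habs φ
    obtain ⟨C, -, hC⟩ := hstep n
    refine ⟨‖c‖ * C, ?_⟩
    rintro _ ⟨k, rfl⟩
    simp only [map_smul, norm_smul]
    exact mul_le_mul_of_nonneg_left (hC k χ hχ) (norm_nonneg c)
  let q : Seminorm ℂ E := Seminorm.of (fun φ => ⨆ k, ‖y k φ‖)
    (fun φ χ => ciSup_le fun k => by
      rw [map_add]
      exact (norm_add_le _ _).trans
        (add_le_add (le_ciSup (hbdd φ) k) (le_ciSup (hbdd χ) k)))
    (fun c φ => by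
      simp only [map_smul, norm_smul]
      rw [Real.mul_iSup_of_nonneg (norm_nonneg c)])
  have hq : Continuous q := by
    refine hcont q fun n => ?_
    obtain ⟨C, -, hC⟩ := hstep n
    refine ⟨C, ?_⟩
    rintro _ ⟨φ, hφ, rfl⟩
    exact ciSup_le fun k => hC k φ hφ
  obtain ⟨C, hC⟩ : ∃ C : ℝ, ∀ φ ∈ S, q φ ≤ C := by
    have h1 : q.ball 0 1 ∈ 𝓝 (0 : E) := q.ball_mem_nhds hq one_pos
    obtain ⟨r, hr0, hr⟩ := (hS h1).exists_pos
    refine ⟨r, fun φ hφ => ?_⟩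
    have h2 := hr (r : ℂ) (by simp [abs_of_pos hr0]) hφ
    obtain ⟨χ, hχ, rfl⟩ := h2
    rw [Seminorm.mem_ball_zero] at hχ
    simp only [map_smul_eq_mul, Complex.norm_real, Real.norm_eq_abs, abs_of_pos hr0]
    nlinarith
  obtain ⟨n, hn⟩ := exists_nat_ge (max C 0)
  refine absurd (hy2 n) (not_lt.2 ((dualSeminorm_le hS (le_max_right C 0) fun φ hφ => ?_).trans hn))
  exact ((le_ciSup (hbdd φ) n).trans (hC φ hφ)).trans (le_max_left _ _)

theorem isFundamentalSequence_dualSeminorm {B : ℕ → Set E} (hB : ∀ n, IsVonNBounded ℂ (B n))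
    (hmono : Monotone B) (habs : ∀ φ, ∃ n, ∃ c : ℂ, ∃ χ ∈ B n, φ = c • χ)
    (hcont : ∀ p : Seminorm ℂ E, (∀ n, BddAbove (p '' B n)) → Continuous p) :
    IsFundamentalSequence fun n => dualSeminorm (B n) (hB n) := by
  refine ⟨fun m n hmn x => dualSeminorm_mono (hB m) (hB n) (hmono hmn) x, ?_⟩
  refine (SeminormFamily.withSeminorms_iff_nhds_eq_iInf _).2 (le_antisymm ?_ ?_)
  · refine le_iInf fun n => ?_
    rw [← tendsto_iff_comap, Metric.tendsto_nhds]
    intro ε hε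
    filter_upwards [ContinuousLinearMap.eventually_nhds_zero_mapsTo (hB n)
      (Metric.ball_mem_nhds (0 : ℂ) (half_pos hε))] with x hx
    rw [dist_zero_right, Real.norm_eq_abs, abs_of_nonneg (apply_nonneg _ _)]
    refine (dualSeminorm_le (hB n) (half_pos hε).le fun φ hφ => ?_).trans_lt (half_lt_self hε)
    exact (mem_ball_zero_iff.1 (hx hφ)).le
  · rw [ContinuousLinearMap.nhds_zero_eq_of_basis Metric.nhds_basis_ball]
    refine le_iInf₂ fun S hS => le_iInf₂ fun ε hε => ?_
    obtain ⟨n, hn⟩ := exists_dualSeminorm_le hB hmono habs hcont hS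
    refine (iInf_le _ n).trans (le_principal_iff.2 ?_)
    refine ⟨Metric.ball 0 (ε / (n + 1)), Metric.ball_mem_nhds _ (by positivity), ?_⟩
    intro x hx φ hφ
    simp only [mem_preimage, mem_ball_zero_iff, Real.norm_eq_abs,
      abs_of_nonneg (apply_nonneg (dualSeminorm (B n) (hB n)) x)] at hx ⊢
    have h1 := (norm_apply_le_dualSeminorm hS x hφ).trans (hn x)
    have h2 : (n : ℝ) * dualSeminorm (B n) (hB n) x ≤
        (n + 1) * dualSeminorm (B n) (hB n) x :=
      mul_le_mul_of_nonneg_right (by linarith) (apply_nonneg _ _)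
    rw [lt_div_iff₀ (by positivity)] at hx
    linarith

variable [IsTopologicalAddGroup E] [ContinuousSMul ℂ E]

/-- A Cauchy sequence converges pointwise, and uniformly on each `B n`. The limit is thus bounded on
each `B n`, so its modulus is a continuous seminorm. Sequences suffice since countably many
seminorms give the topology. -/
theorem completeSpace_strongDual {B : ℕ → Set E} (hB : ∀ n, IsVonNBounded ℂ (B n))
    (hmono : Monotone B) (habs : ∀ φ, ∃ n, ∃ c : ℂ, ∃ χ ∈ B n, φ = c • χ)
    (hcont : ∀ p : Seminorm ℂ E, (∀ n, BddAbove (p '' B n)) → Continuous p) :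
    CompleteSpace (StrongDual ℂ E) := by
  have hws := (isFundamentalSequence_dualSeminorm hB hmono habs hcont).2
  have := hws.firstCountableTopology
  have : (uniformity (StrongDual ℂ E)).IsCountablyGenerated :=
    IsUniformAddGroup.uniformity_countably_generated
  refine UniformSpace.complete_of_cauchySeq_tendsto fun u hu => ?_
  have hlim : ∀ φ, ∃ z, Tendsto (fun k => u k φ) atTop (𝓝 z) := fun φ =>
    cauchySeq_tendsto_of_complete (hu.map
      (uniformContinuous_addMonoidHom_of_continuous
        (f := (⟨⟨fun x => x φ, rfl⟩, fun _ _ => rfl⟩ : StrongDual ℂ E →+ ℂ))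
        (continuous_eval_const φ)))
  choose v hv using hlim
  have hC : ∀ n, ∀ ε > 0, ∃ K, ∀ k ≥ K, ∀ φ ∈ B n, ‖u k φ - v φ‖ ≤ ε := by
    intro n ε hε
    have h1 : {x : StrongDual ℂ E | dualSeminorm (B n) (hB n) x < ε} ∈
        𝓝 (0 : StrongDual ℂ E) := by
      have := (dualSeminorm (B n) (hB n)).ball_mem_nhds (hws.continuous_seminorm n) hε
      simpa [Seminorm.ball_zero_eq] using this
    have h2 : {p : StrongDual ℂ E × StrongDual ℂ E |
        dualSeminorm (B n) (hB n) (p.2 - p.1) < ε} ∈ uniformity (StrongDual ℂ E) := by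
      rw [uniformity_eq_comap_nhds_zero]
      exact preimage_mem_comap h1
    obtain ⟨K, hK⟩ := hu.mem_entourage h2
    refine ⟨K, fun k hk φ hφ => ?_⟩
    refine le_of_tendsto ((tendsto_const_nhds.sub (hv φ)).norm) ?_
    filter_upwards [eventually_ge_atTop K] with j hj
    have := norm_apply_le_dualSeminorm (hB n) (u k - u j) hφ
    exact this.trans (hK j k hj hk).le
  let w : E →ₗ[ℂ] ℂ :=
    { toFun := v
      map_add' := fun φ χ => tendsto_nhds_unique (hv (φ + χ))
        (by simpa using (hv φ).add (hv χ))
      map_smul' := fun c φ => tendsto_nhds_unique (hv (c • φ))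
        (by simpa using (hv φ).const_mul c) }
  have hw : Continuous w := by
    have h1 : Continuous ((normSeminorm ℂ ℂ).comp w) := by
      refine hcont _ fun n => ?_
      obtain ⟨K, hK⟩ := hC n 1 one_pos
      refine ⟨1 + dualSeminorm (B n) (hB n) (u K), ?_⟩
      rintro _ ⟨φ, hφ, rfl⟩
      have h2 := hK K le_rfl φ hφ
      have h3 := norm_apply_le_dualSeminorm (hB n) (u K) hφ
      have h4 : ‖v φ‖ ≤ ‖u K φ - v φ‖ + ‖u K φ‖ := by
        rw [norm_sub_rev]
        simpa using norm_add_le (v φ - u K φ) (u K φ)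
      change ‖v φ‖ ≤ _
      linarith
    have h2 : Tendsto (fun φ => ‖w φ‖) (𝓝 0) (𝓝 0) := by
      have h3 := h1.tendsto 0
      rwa [map_zero] at h3
    exact continuous_of_continuousAt_zero w
      (by rw [ContinuousAt, map_zero]; exact tendsto_zero_iff_norm_tendsto_zero.2 h2)
  refine ⟨⟨w, hw⟩, ?_⟩
  rw [hws.tendsto_nhds]
  intro n ε hε
  obtain ⟨K, hK⟩ := hC n (ε / 2) (half_pos hε)
  filter_upwards [eventually_ge_atTop K] with k hk
  exact (dualSeminorm_le (hB n) (half_pos hε).le fun φ hφ => hK k hk φ hφ).trans_lt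
    (half_lt_self hε)

theorem isFrechetSpace_strongDual {B : ℕ → Set E} (hB : ∀ n, IsVonNBounded ℂ (B n))
    (hmono : Monotone B) (habs : ∀ φ, ∃ n, ∃ c : ℂ, ∃ χ ∈ B n, φ = c • χ)
    (hcont : ∀ p : Seminorm ℂ E, (∀ n, BddAbove (p '' B n)) → Continuous p) :
    IsFrechetSpace (StrongDual ℂ E) :=
  ⟨inferInstance, completeSpace_strongDual hB hmono habs hcont,
    ⟨_, isFundamentalSequence_dualSeminorm hB hmono habs hcont⟩⟩

end DualSeminorms

/-! ### From a decomposition of balls to the interpolation inequality. -/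

section UnderlineDN

/-- A continuous seminorm is dominated by finitely many `q i`, hence by one, by monotonicity.
Allowing all `n' ≥ n` lets indices be raised later. -/
theorem IsFundamentalSequence.exists_le {X : Type*} [AddCommGroup X] [Module ℂ X]
    [TopologicalSpace X] {p q : ℕ → Seminorm ℂ X} (hp : IsFundamentalSequence p)
    (hq : IsFundamentalSequence q) (m : ℕ) :
    ∃ n : ℕ, ∃ C : ℝ, 0 < C ∧ ∀ n' ≥ n, ∀ x, p m x ≤ C * q n' x := by
  obtain ⟨s, C, hC, h⟩ := Seminorm.bound_of_continuous hq.2 (p m) (hp.2.continuous_seminorm m)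
  obtain ⟨n, hn⟩ := s.exists_le
  refine ⟨n, C, by positivity, fun n' hn' x => (h x).trans ?_⟩
  have h1 : s.sup q ≤ q n' := Finset.sup_le fun i hi => hq.1 ((hn i hi).trans hn')
  exact mul_le_mul_of_nonneg_left (h1 x) C.2

/-- It suffices to check the condition for one fundamental sequence. -/
theorem SatisfiesUnderlineDN.of_sequence {X : Type*} [AddCommGroup X] [Module ℂ X]
    [UniformSpace X] [IsUniformAddGroup X] {p : ℕ → Seminorm ℂ X} (hp : IsFundamentalSequence p)
    (h : ∃ n : ℕ, ∀ m : ℕ, n ≤ m → ∃ θ ∈ Ioo (0 : ℝ) 1, ∃ k : ℕ, m ≤ k ∧ ∃ C : ℝ, 0 < C ∧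
      ∀ x : X, p m x ≤ C * p n x ^ θ * p k x ^ (1 - θ)) : SatisfiesUnderlineDN X := by
  intro q hq
  obtain ⟨n₀, h⟩ := h
  obtain ⟨n, C₁, hC₁, h₁⟩ := hp.exists_le hq n₀
  refine ⟨n, fun m hm => ?_⟩
  obtain ⟨m', C₂, hC₂, h₂⟩ := hq.exists_le hp m
  -- The maximum makes the index both large enough to dominate `q m` and admissible in the condition
  -- for `p`.
  obtain ⟨θ, hθ, k', -, C, hC, hdn⟩ := h (max m' n₀) (le_max_right _ _)
  obtain ⟨k, C₃, hC₃, h₃⟩ := hp.exists_le hq k'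
  refine ⟨θ, hθ, max k m, le_max_right _ _, C₂ * (C * C₁ ^ θ * C₃ ^ (1 - θ)), by positivity,
    fun x => ?_⟩
  have hq0 : ∀ i, 0 ≤ q i x := fun i => apply_nonneg _ _
  have hp0 : ∀ i, 0 ≤ p i x := fun i => apply_nonneg _ _
  calc q m x ≤ C₂ * p (max m' n₀) x := h₂ _ (le_max_left _ _) x
    _ ≤ C₂ * (C * p n₀ x ^ θ * p k' x ^ (1 - θ)) := by gcongr; exact hdn x
    _ ≤ C₂ * (C * (C₁ * q n x) ^ θ * (C₃ * q (max k m) x) ^ (1 - θ)) := by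
        have e1 := h₁ n le_rfl x
        have e2 := h₃ (max k m) (le_max_left _ _) x
        have e3 : p n₀ x ^ θ ≤ (C₁ * q n x) ^ θ :=
          Real.rpow_le_rpow (hp0 _) e1 hθ.1.le
        have e4 : p k' x ^ (1 - θ) ≤ (C₃ * q (max k m) x) ^ (1 - θ) :=
          Real.rpow_le_rpow (hp0 _) e2 (by linarith [hθ.2])
        have := hp0 n₀
        have := hp0 k'
        have := hq0 n
        gcongr
    _ = C₂ * (C * C₁ ^ θ * C₃ ^ (1 - θ)) * q n x ^ θ * q (max k m) x ^ (1 - θ) := by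
        rw [Real.mul_rpow hC₁.le (hq0 _), Real.mul_rpow hC₃.le (hq0 _)]
        ring

/-- Optimization of `P ≤ C (e^{aR} Q + e^{-bR} S)` over `R ≥ R₀`. -/
theorem le_rpow_mul_rpow_of_forall_exp {a b C R₀ P Q S : ℝ} (ha : 0 < a) (hb : 0 < b) (hC : 0 < C)
    (hQ : 0 ≤ Q) (hQP : Q ≤ P) (hPS : P ≤ S)
    (h : ∀ R ≥ R₀, P ≤ C * Real.exp (a * R) * Q + C * Real.exp (-(b * R)) * S) :
    P ≤ (2 * C + Real.exp (b * R₀)) * Q ^ (b / (a + b)) * S ^ (1 - b / (a + b)) := by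
  have hab : 0 < a + b := by positivity
  have hθ : 1 - b / (a + b) = a / (a + b) := by field_simp; ring
  -- If `Q = 0`, letting `R → ∞` forces `P ≤ 0`.
  rcases eq_or_lt_of_le hQ with h0 | h0
  · rw [← h0, Real.zero_rpow (by positivity)]
    simp only [mul_zero, zero_mul]
    have ht : Tendsto (fun R : ℝ => C * Real.exp (a * R) * Q + C * Real.exp (-(b * R)) * S) atTop
        (𝓝 0) := by
      have h1 : Tendsto (fun R : ℝ => Real.exp (-(b * R))) atTop (𝓝 0) :=
        Real.tendsto_exp_neg_atTop_nhds_zero.comp (tendsto_id.const_mul_atTop hb)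
      simpa [← h0] using (h1.const_mul C).mul_const S
    exact ge_of_tendsto ht ((eventually_ge_atTop R₀).mono h)
  · have hS : 0 < S := h0.trans_le (hQP.trans hPS)
    -- This `R` balances the two terms: `e^{aR} Q = e^{-bR} S`.
    set R := Real.log (S / Q) / (a + b) with hR
    have hS' : S = Q * Real.exp ((a + b) * R) := by
      rw [hR, mul_div_cancel₀ _ hab.ne', Real.exp_log (by positivity)]
      field_simp
    have e1 : Q ^ (b / (a + b)) * S ^ (1 - b / (a + b)) = Q * Real.exp (a * R) := by
      rw [hθ, hS', Real.mul_rpow hQ (Real.exp_pos _).le, ← mul_assoc, ← Real.rpow_add h0,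
        ← Real.exp_mul]
      have : b / (a + b) + a / (a + b) = 1 := by field_simp; ring
      rw [this, Real.rpow_one]
      congr 2
      field_simp
    rw [mul_assoc, e1]
    have hpos : 0 < Q * Real.exp (a * R) := by positivity
    rcases le_total R₀ R with hRR | hRR
    · have h2 := h R hRR
      have h3 : Real.exp (-(b * R)) * S = Q * Real.exp (a * R) := by
        rw [hS', mul_left_comm, ← Real.exp_add]
        ring_nf
      have h4 : C * Real.exp (a * R) * Q + C * Real.exp (-(b * R)) * S =
          2 * C * (Q * Real.exp (a * R)) := by
        rw [mul_assoc C (Real.exp (-(b * R))), h3]; ring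
      rw [h4] at h2
      have : 0 < Real.exp (b * R₀) * (Q * Real.exp (a * R)) := by positivity
      linarith
    -- When the optimal `R` lies below `R₀`, the trivial bound `P ≤ S` suffices; it accounts for
    -- `e^{b R₀}` in the constant.
    · have h5 : S ≤ Real.exp (b * R₀) * (Q * Real.exp (a * R)) := by
        have h6 : S = Real.exp (b * R) * (Q * Real.exp (a * R)) := by
          rw [hS', add_mul, Real.exp_add]; ring
        rw [h6]
        gcongr
      have : 0 < 2 * C * (Q * Real.exp (a * R)) := by positivity
      linarith

/-- The condition for the strong dual, from a decomposition of the sets `B m`. -/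
theorem satisfiesUnderlineDN_strongDual {E : Type*} [AddCommGroup E] [Module ℂ E]
    [TopologicalSpace E] [IsTopologicalAddGroup E] [ContinuousSMul ℂ E]
    {B : ℕ → Set E} (hB : ∀ n, Bornology.IsVonNBounded ℂ (B n))
    (hmono : Monotone B) (habs : ∀ φ, ∃ n, ∃ c : ℂ, ∃ χ ∈ B n, φ = c • χ)
    (hcont : ∀ p : Seminorm ℂ E, (∀ n, BddAbove (p '' B n)) → Continuous p)
    (hdec : ∀ m, ∃ k ≥ m, ∃ a > 0, ∃ b > 0, ∃ C > 0, ∃ R₀ : ℝ, ∀ R ≥ R₀, ∀ φ ∈ B m,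
      ∃ φ₁ ∈ B 0, ∃ φ₂ ∈ B k, φ = ((C * Real.exp (a * R) : ℝ) : ℂ) • φ₁ +
        ((C * Real.exp (-(b * R)) : ℝ) : ℂ) • φ₂) :
    SatisfiesUnderlineDN (StrongDual ℂ E) := by
  have hp := isFundamentalSequence_dualSeminorm hB hmono habs hcont
  refine SatisfiesUnderlineDN.of_sequence hp ⟨0, fun m _ => ?_⟩
  obtain ⟨k, hk, a, ha, b, hb, C, hC, R₀, h⟩ := hdec m
  refine ⟨b / (a + b), ⟨by positivity, (div_lt_one (by positivity)).2 (by linarith)⟩, k, hk,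
    2 * C + Real.exp (b * R₀), by positivity, fun x => ?_⟩
  refine le_rpow_mul_rpow_of_forall_exp ha hb hC (apply_nonneg _ _) (hp.1 (Nat.zero_le m) x)
    (hp.1 hk x) fun R hR => dualSeminorm_le (hB m) ?_ fun φ hφ => ?_
  · have := apply_nonneg (dualSeminorm (B 0) (hB 0)) x
    have := apply_nonneg (dualSeminorm (B k) (hB k)) x
    positivity
  · obtain ⟨φ₁, h₁, φ₂, h₂, rfl⟩ := h R hR φ hφ
    rw [map_add, map_smul, map_smul]
    refine (norm_add_le _ _).trans ?_
    rw [norm_smul, norm_smul, Complex.norm_real, Complex.norm_real, Real.norm_of_nonneg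
      (by positivity), Real.norm_of_nonneg (by positivity)]
    gcongr
    · exact norm_apply_le_dualSeminorm (hB 0) x h₁
    · exact norm_apply_le_dualSeminorm (hB k) x h₂

end UnderlineDN

/-! ### Estimates for the weight, its Young conjugate and the choice of parameters. -/

namespace WeightFunction

variable (ω : WeightFunction)

theorem psi_mono {x y : ℝ} (h : x ≤ y) : ω.psi x ≤ ω.psi y :=
  ω.monotoneOn (Real.exp_pos x).le (Real.exp_pos y).le (Real.exp_le_exp.2 h)

theorem psi_zero : ω.psi 0 = 0 := ω.eq_zero _ (by simp)

theorem continuous_psi : Continuous ω.psi :=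
  ω.continuousOn.comp_continuous Real.continuous_exp fun x => (Real.exp_pos x).le

theorem mul_le_psi_add_psiStar {x y : ℝ} (hx : 0 ≤ x) (hy : 0 ≤ y) :
    x * y ≤ ω.psi x + ω.psiStar y := by
  have := le_ciSup (ω.bddAbove_psiStar hy) ⟨x, hx⟩
  change x * y - ω.psi x ≤ ω.psiStar y at this
  linarith

theorem psiStar_le {y C : ℝ} (h : ∀ x, 0 ≤ x → x * y - ω.psi x ≤ C) : ω.psiStar y ≤ C := by
  have : Nonempty (Ici (0 : ℝ)) := ⟨⟨0, self_mem_Ici⟩⟩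
  exact ciSup_le fun x => h x x.2

theorem psiStar_zero : ω.psiStar 0 = 0 := by
  refine le_antisymm (ω.psiStar_le fun x _ => ?_) ?_
  · have := ω.psi_nonneg x
    simpa
  · have := ω.mul_le_psi_add_psiStar le_rfl le_rfl
    simpa [ω.psi_zero] using this

/-- A supremum of affine functions is convex. The arguments `2y`, `2z` are what later turn the index
`m` into `2m`. -/
theorem psiStar_midpoint {y z : ℝ} (hy : 0 ≤ y) (hz : 0 ≤ z) :
    2 * ω.psiStar (y + z) ≤ ω.psiStar (2 * y) + ω.psiStar (2 * z) := by
  have : ω.psiStar (y + z) ≤ (ω.psiStar (2 * y) + ω.psiStar (2 * z)) / 2 := by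
    refine ω.psiStar_le fun x hx => ?_
    have h1 := ω.mul_le_psi_add_psiStar hx (by positivity : 0 ≤ 2 * y)
    have h2 := ω.mul_le_psi_add_psiStar hx (by positivity : 0 ≤ 2 * z)
    linarith
  linarith

/-- The right derivative of the convex function `ψ` at the interior point `X` serves; it dominates
the slope of the chord from `0`, which is nonnegative since `ψ` increases. -/
theorem exists_subgradient {X : ℝ} (hX : 0 < X) :
    ∃ y, 0 ≤ y ∧ ∀ x, 0 ≤ x → ω.psi X + y * (x - X) ≤ ω.psi x := by
  have hc : ConvexOn ℝ (Ici 0) ω.psi := ω.delta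
  have hi : X ∈ interior (Ici (0 : ℝ)) := by simpa using hX
  have hleft : ∀ x, 0 ≤ x → x < X → slope ω.psi x X ≤ derivWithin ω.psi (Ioi X) X :=
    fun x hx hxX => (hc.slope_le_leftDeriv_of_mem_interior hx hi hxX).trans
      (hc.leftDeriv_le_rightDeriv_of_mem_interior hi)
  refine ⟨derivWithin ω.psi (Ioi X) X, ?_, fun x hx => ?_⟩
  · refine le_trans ?_ (hleft 0 le_rfl hX)
    rw [slope_def_field]
    exact div_nonneg (sub_nonneg.2 (ω.psi_mono hX.le)) (by linarith)
  · rcases lt_trichotomy x X with h | h | h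
    · have := hleft x hx h
      rw [slope_def_field, div_le_iff₀ (by linarith)] at this
      linarith
    · simp [h]
    · have := hc.rightDeriv_le_slope_of_mem_interior hi hx h
      rw [slope_def_field, le_div_iff₀ (by linarith)] at this
      linarith

/-- In the exponential variable, (α) bounds the effect of a shift by `log 2` for large arguments.
The added `1` absorbs the remaining ones, and iteration reaches any shift `c`. -/
theorem exists_psi_add_le (c : ℝ) :
    ∃ L : ℝ, 0 < L ∧ ∀ x, 0 ≤ x → ω.psi (x + c) ≤ L * (ω.psi x + 1) := by
  obtain ⟨K, hK0, hK⟩ := ω.alpha.exists_pos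
  obtain ⟨T, hT⟩ := eventually_atTop.1 (hK.bound.and (eventually_gt_atTop 0))
  have h1 : ∀ x, Real.log (max T 1) ≤ x → ω.psi (x + Real.log 2) ≤ K * ω.psi x := by
    intro x hx
    rw [Real.log_le_iff_le_exp (by positivity)] at hx
    have h2 := (hT (Real.exp x) ((le_max_left _ _).trans hx)).1
    rw [Real.norm_of_nonneg (ω.nonneg _ (by positivity)),
      Real.norm_of_nonneg (ω.nonneg _ (by positivity))] at h2
    rwa [psi, psi, Real.exp_add, Real.exp_log two_pos, mul_comm]
  set X₀ := Real.log (max T 1)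
  have h2 : ∀ x, ω.psi (x + Real.log 2) ≤ (K + ω.psi (X₀ + Real.log 2)) * (ω.psi x + 1) := by
    intro x
    have hx := ω.psi_nonneg x
    have hX := ω.psi_nonneg (X₀ + Real.log 2)
    have : 0 ≤ ω.psi (X₀ + Real.log 2) * ω.psi x := by positivity
    have : 0 ≤ K * ω.psi x := by positivity
    rcases le_total X₀ x with h | h
    · have := h1 x h
      linarith
    · have : ω.psi (x + Real.log 2) ≤ ω.psi (X₀ + Real.log 2) := ω.psi_mono (by linarith)
      linarith
  have h3 : ∀ j : ℕ, ∃ L : ℝ, 0 < L ∧ ∀ x, ω.psi (x + j * Real.log 2) ≤ L * (ω.psi x + 1) := by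
    intro j
    induction j with
    | zero => exact ⟨1, one_pos, fun x => by simp⟩
    | succ j ih =>
      obtain ⟨L, hL, h⟩ := ih
      have hX := ω.psi_nonneg (X₀ + Real.log 2)
      refine ⟨(K + ω.psi (X₀ + Real.log 2)) * (L + 1), by positivity, fun x => ?_⟩
      have hx := ω.psi_nonneg x
      have e : x + (j + 1 : ℕ) * Real.log 2 = x + j * Real.log 2 + Real.log 2 := by
        push_cast; ring
      rw [e, mul_assoc]
      refine (h2 _).trans ?_
      gcongr
      have := h x
      linarith
  obtain ⟨j, hj⟩ := exists_nat_ge (c / Real.log 2)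
  obtain ⟨L, hL, h⟩ := h3 j
  rw [div_le_iff₀ (Real.log_pos one_lt_two)] at hj
  exact ⟨L, hL, fun x _ => (ω.psi_mono (by linarith)).trans (h x)⟩

/-- This is (γ) in the exponential variable, with small arguments absorbed in `C`. -/
theorem exists_le_mul_psi_add {ε : ℝ} (hε : 0 < ε) : ∃ C : ℝ, ∀ x, x ≤ ε * ω.psi x + C := by
  obtain ⟨A, hA⟩ := eventually_atTop.1 ((ω.gamma.comp_tendsto Real.tendsto_exp_atTop).def hε)
  refine ⟨max A 0, fun x => ?_⟩
  have hx := ω.psi_nonneg x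
  rcases le_total A x with h | h
  · have h1 := hA x h
    simp only [Function.comp_apply, Real.log_exp] at h1
    rw [Real.norm_of_nonneg (ω.nonneg _ (Real.exp_pos x).le)] at h1
    have := (Real.le_norm_self x).trans h1
    have : x ≤ ε * ω.psi x := this
    linarith [le_max_right A 0]
  · have : 0 ≤ ε * ω.psi x := by positivity
    linarith [le_max_left A 0]

theorem exists_psi_eq {R : ℝ} (hR : 0 < R) : ∃ X, 0 < X ∧ ω.psi X = R := by
  obtain ⟨C, hC⟩ := ω.exists_le_mul_psi_add one_pos
  have h1 : R ≤ ω.psi (max (R + C) 0) := by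
    have := hC (max (R + C) 0)
    linarith [le_max_left (R + C) 0]
  obtain ⟨X, hX, h⟩ := intermediate_value_Icc (le_max_right (R + C) 0)
    ω.continuous_psi.continuousOn ⟨ω.psi_zero.trans_le hR.le, h1⟩
  refine ⟨X, lt_of_le_of_ne hX.1 ?_, h⟩
  rintro rfl
  rw [ω.psi_zero] at h
  exact hR.ne h

/-- The choice of the scale `ρ` and of the order `N` in the smoothing argument. -/
theorem exists_scale_and_order {m : ℕ} (hm : 1 ≤ m) {A D G K : ℝ} (hA : 1 ≤ A) (hD : 0 ≤ D)
    (hG : 1 ≤ G) (hK : 0 ≤ K) :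
    ∃ a > 0, ∃ b > 0, ∃ C > 0, ∀ R > 0, ∃ ρ > 0, ∃ N : ℕ,
      (∀ j : ℕ, G ^ N * K * (A * ρ) ^ j ≤
        C * Real.exp (a * R) * Real.exp (ω.psiStar j)) ∧
      ∀ j : ℕ, (D / ρ) ^ N * Real.exp (1 / (m : ℝ) * ω.psiStar (m * (j + N : ℕ))) ≤
        C * Real.exp (-(b * R)) *
          Real.exp (1 / ((2 * m : ℕ) : ℝ) * ω.psiStar ((2 * m : ℕ) * j)) := by
  have hm0 : (0 : ℝ) < m := by exact_mod_cast hm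
  have hm1 : (1 : ℝ) ≤ m := by exact_mod_cast hm
  obtain ⟨L₁, hL₁, h₁⟩ := ω.exists_psi_add_le 1
  obtain ⟨L₂, hL₂, h₂⟩ := ω.exists_psi_add_le (Real.log (A * max D 1))
  obtain ⟨C₄, h₄⟩ := ω.exists_le_mul_psi_add (by positivity : 0 < 1 / (4 * (m : ℝ)))
  have hlG : 0 ≤ Real.log G := Real.log_nonneg hG
  have hD1 : 0 < max D 1 := by positivity
  set a := Real.log G * L₁ + L₂ with ha
  have ha0 : 0 < a := by positivity
  -- `log G * L₁` pays for `G ^ N` and `L₂` for the powers of `ρ`. Both estimates contain `R + 1`,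
  -- whence the factor `exp a` in the constant; `exp C₄` is the loss in (γ).
  refine ⟨a, ha0, 1 / (4 * m), by positivity, K * Real.exp a + Real.exp C₄, by positivity,
    fun R hR => ?_⟩
  obtain ⟨X, hX, hXR⟩ := ω.exists_psi_eq hR
  obtain ⟨y, hy, hyX⟩ := ω.exists_subgradient hX
  -- The subgradient inequality at `X + 1`, combined with the shift estimate.
  have hy1 : y ≤ L₁ * (R + 1) := by
    have e1 := hyX (X + 1) (by linarith)
    have e2 := h₁ X hX.le
    rw [hXR] at e1 e2
    linarith
  -- `N` is the largest integer with `2mN ≤ y`; rounding will cost one factor `e^X`.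
  have hN1 : (⌊y / (2 * m)⌋₊ : ℝ) ≤ y / (2 * m) := Nat.floor_le (by positivity)
  have hN2 : y / (2 * m) < ⌊y / (2 * m)⌋₊ + 1 := Nat.lt_floor_add_one _
  set N := ⌊y / (2 * m)⌋₊ with hN
  rw [le_div_iff₀ (by positivity)] at hN1
  rw [div_lt_iff₀ (by positivity)] at hN2
  have hN0 : (0 : ℝ) ≤ N := Nat.cast_nonneg N
  -- The factor `max D 1` gives `D / ρ ≤ e^{-X}` and also keeps the shift `log (A * max D 1)`
  -- nonnegative.
  refine ⟨max D 1 * Real.exp X, by positivity, N, fun j => ?_, fun j => ?_⟩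
  · have e1 : A * (max D 1 * Real.exp X) = Real.exp (X + Real.log (A * max D 1)) := by
      rw [Real.exp_add, Real.exp_log (by positivity)]; ring
    have hc : 0 ≤ Real.log (A * max D 1) := Real.log_nonneg
      (one_le_mul_of_one_le_of_one_le hA (le_max_right _ _))
    have e2 : (A * (max D 1 * Real.exp X)) ^ j ≤ Real.exp (L₂ * (R + 1) + ω.psiStar j) := by
      rw [e1, ← Real.exp_nat_mul, Real.exp_le_exp]
      have e3 := ω.mul_le_psi_add_psiStar (by linarith : 0 ≤ X + Real.log (A * max D 1))
        (Nat.cast_nonneg j)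
      have e4 := h₂ X hX.le
      rw [hXR] at e4
      linarith
    have e5 : G ^ N ≤ Real.exp (Real.log G * (L₁ * (R + 1))) := by
      rw [← Real.rpow_natCast, Real.rpow_def_of_pos (by linarith), Real.exp_le_exp]
      have : (N : ℝ) ≤ L₁ * (R + 1) := by nlinarith
      gcongr
    calc G ^ N * K * (A * (max D 1 * Real.exp X)) ^ j
        ≤ Real.exp (Real.log G * (L₁ * (R + 1))) * K * Real.exp (L₂ * (R + 1) + ω.psiStar j) := by
          gcongr
      _ = K * Real.exp a * Real.exp (a * R) * Real.exp (ω.psiStar j) := by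
          rw [mul_right_comm, ← Real.exp_add, mul_assoc K, mul_assoc K, ← Real.exp_add,
            ← Real.exp_add, mul_comm K]
          congr 2
          rw [ha]; ring
      _ ≤ _ := by
          gcongr
          linarith [Real.exp_pos C₄]
  · have e1 : (D / (max D 1 * Real.exp X)) ^ N ≤ Real.exp (-(N * X)) := by
      have : D / (max D 1 * Real.exp X) ≤ Real.exp (-X) := by
        rw [div_le_iff₀ (by positivity), mul_left_comm, ← Real.exp_add]
        simp
      calc _ ≤ Real.exp (-X) ^ N := by gcongr
        _ = _ := by rw [← Real.exp_nat_mul]; ring_nf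
    -- Since `2mN ≤ y`, this is at most `ψ*(y)`, and the supremum for a subgradient `y` is attained
    -- at `X`.
    have e2 : ω.psiStar (2 * (m * N)) ≤ X * y - R := by
      refine ω.psiStar_le fun x hx => ?_
      have e3 := hyX x hx
      rw [hXR] at e3
      have e4 : x * (2 * (m * N)) ≤ x * y := by
        apply mul_le_mul_of_nonneg_left _ hx
        linarith
      linarith
    have e5 := ω.psiStar_midpoint (by positivity : (0 : ℝ) ≤ m * j)
      (by positivity : (0 : ℝ) ≤ m * N)
    have e6 : (m : ℝ) * (j + N : ℕ) = m * j + m * N := by push_cast; ring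
    have e7 := h₄ X
    rw [hXR] at e7
    have e8 : X * y ≤ X * ((N + 1) * (2 * m)) := mul_le_mul_of_nonneg_left hN2.le hX.le
    -- The terms in `N` cancel and leave `X - R/(2m)`; half of the gain `R/(2m)` absorbs `X` by (γ).
    have e9 : -(N * X) + 1 / (m : ℝ) * ω.psiStar (m * (j + N : ℕ)) ≤
        C₄ + -(1 / (4 * m) * R) + 1 / ((2 * m : ℕ) : ℝ) * ω.psiStar ((2 * m : ℕ) * j) := by
      have e10 : 1 / (m : ℝ) * ω.psiStar (m * (j + N : ℕ)) ≤
          1 / (2 * m) * (ω.psiStar (2 * (m * j)) + (X * ((N + 1) * (2 * m)) - R)) := by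
        rw [e6]
        calc 1 / (m : ℝ) * ω.psiStar (m * j + m * N)
            = 1 / (2 * m) * (2 * ω.psiStar (m * j + m * N)) := by field_simp
          _ ≤ _ := by gcongr; linarith
      have e11 : 1 / (2 * (m : ℝ)) * (ω.psiStar (2 * (m * j)) + (X * ((N + 1) * (2 * m)) - R)) =
          1 / (2 * m) * ω.psiStar (2 * (m * j)) + X * (N + 1) - 2 * (1 / (4 * m) * R) := by
        field_simp
        ring
      push_cast
      rw [mul_assoc 2 (m : ℝ) j]
      push_cast at e10
      linarith
    calc _ ≤ Real.exp (-(N * X)) * Real.exp (1 / (m : ℝ) * ω.psiStar (m * (j + N : ℕ))) := by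
          gcongr
      _ ≤ Real.exp (C₄ + -(1 / (4 * m) * R) +
          1 / ((2 * m : ℕ) : ℝ) * ω.psiStar ((2 * m : ℕ) * j)) := by
          rw [← Real.exp_add]; exact Real.exp_le_exp.2 e9
      _ = Real.exp C₄ * Real.exp (-(1 / (4 * m) * R)) *
          Real.exp (1 / ((2 * m : ℕ) : ℝ) * ω.psiStar ((2 * m : ℕ) * j)) := by
          rw [Real.exp_add, Real.exp_add]
      _ ≤ _ := by
          gcongr
          have : 0 ≤ K * Real.exp a := by positivity
          linarith

end WeightFunction

/-! ### Derivatives along lists of coordinates. -/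

section ListDeriv

variable {d : ℕ}

/-- The derivative `∂_{i₁} ⋯ ∂_{i_k} f` along a list `[i₁, …, i_k]` of coordinates. -/
noncomputable def listDeriv (l : List (Fin d)) (f : EuclideanSpace ℝ (Fin d) → ℂ) :
    EuclideanSpace ℝ (Fin d) → ℂ :=
  l.foldr partialDeriv f

theorem listDeriv_nil (f : EuclideanSpace ℝ (Fin d) → ℂ) : listDeriv [] f = f := rfl

theorem listDeriv_cons (i : Fin d) (l : List (Fin d)) (f : EuclideanSpace ℝ (Fin d) → ℂ) :
    listDeriv (i :: l) f = partialDeriv i (listDeriv l f) := rfl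

theorem listDeriv_append (l l' : List (Fin d)) (f : EuclideanSpace ℝ (Fin d) → ℂ) :
    listDeriv (l ++ l') f = listDeriv l (listDeriv l' f) := List.foldr_append

theorem ContDiff.listDeriv {f : EuclideanSpace ℝ (Fin d) → ℂ} (hf : ContDiff ℝ (⊤ : ℕ∞) f)
    (l : List (Fin d)) : ContDiff ℝ (⊤ : ℕ∞) (listDeriv l f) := by
  induction l with
  | nil => exact hf
  | cons i l ih => exact ih.partialDeriv i

theorem listDeriv_add {f g : EuclideanSpace ℝ (Fin d) → ℂ} (hf : ContDiff ℝ (⊤ : ℕ∞) f)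
    (hg : ContDiff ℝ (⊤ : ℕ∞) g) (l : List (Fin d)) :
    listDeriv l (f + g) = listDeriv l f + listDeriv l g := by
  induction l with
  | nil => rfl
  | cons i l ih => rw [listDeriv_cons, ih, partialDeriv_add (hf.listDeriv l) (hg.listDeriv l)]; rfl

theorem listDeriv_smul {f : EuclideanSpace ℝ (Fin d) → ℂ} (hf : ContDiff ℝ (⊤ : ℕ∞) f) (c : ℂ)
    (l : List (Fin d)) : listDeriv l (c • f) = c • listDeriv l f := by
  induction l with
  | nil => rfl
  | cons i l ih => rw [listDeriv_cons, ih, partialDeriv_smul (hf.listDeriv l)]; rfl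

theorem listDeriv_sub {f g : EuclideanSpace ℝ (Fin d) → ℂ} (hf : ContDiff ℝ (⊤ : ℕ∞) f)
    (hg : ContDiff ℝ (⊤ : ℕ∞) g) (l : List (Fin d)) :
    listDeriv l (f - g) = listDeriv l f - listDeriv l g := by
  have e : ∀ u v : EuclideanSpace ℝ (Fin d) → ℂ, u - v = u + (-1 : ℂ) • v := fun u v => by
    rw [neg_one_smul, sub_eq_add_neg]
  have h : ContDiff ℝ (⊤ : ℕ∞) ((-1 : ℂ) • g) := contDiff_const.smul hg
  rw [e, e, listDeriv_add hf h, listDeriv_smul hg]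

theorem partialDeriv_comm {f : EuclideanSpace ℝ (Fin d) → ℂ} (hf : ContDiff ℝ (⊤ : ℕ∞) f)
    (i j : Fin d) : partialDeriv i (partialDeriv j f) = partialDeriv j (partialDeriv i f) := by
  funext x
  have hd : DifferentiableAt ℝ (fderiv ℝ f) x :=
    (hf.fderiv_right (m := 1) (by norm_cast)).differentiable (by simp) x
  have h : ∀ i j : Fin d, partialDeriv i (partialDeriv j f) x =
      fderiv ℝ (fderiv ℝ f) x (EuclideanSpace.single i 1) (EuclideanSpace.single j 1) := by
    intro i j
    change fderiv ℝ (fun z => fderiv ℝ f z (EuclideanSpace.single j 1)) x _ = _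
    rw [fderiv_clm_apply hd (differentiableAt_const _)]
    simp
  rw [h, h]
  exact (hf.contDiffAt.isSymmSndFDerivAt (by simpa using by norm_cast)).eq _ _

theorem listDeriv_perm {f : EuclideanSpace ℝ (Fin d) → ℂ} (hf : ContDiff ℝ (⊤ : ℕ∞) f)
    {l l' : List (Fin d)} (h : l.Perm l') : listDeriv l f = listDeriv l' f := by
  induction h with
  | nil => rfl
  | cons i _ ih => rw [listDeriv_cons, ih, listDeriv_cons]
  | swap i j l => exact partialDeriv_comm (hf.listDeriv l) j i
  | trans _ _ ih₁ ih₂ => exact ih₁.trans ih₂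

/-- The list in which each `i` occurs `α i` times. -/
def multiIndexList (α : Fin d → ℕ) : List (Fin d) :=
  (List.finRange d).flatMap fun i => List.replicate (α i) i

theorem multiDeriv_eq_listDeriv (α : Fin d → ℕ) (f : EuclideanSpace ℝ (Fin d) → ℂ) :
    multiDeriv α f = listDeriv (multiIndexList α) f := by
  have h : ∀ (i : Fin d) (k : ℕ) (g : EuclideanSpace ℝ (Fin d) → ℂ),
      listDeriv (List.replicate k i) g = (partialDeriv i)^[k] g := by
    intro i k g
    induction k with
    | zero => rfl
    | succ k ih => rw [List.replicate_succ, listDeriv_cons, ih, Function.iterate_succ_apply']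
  unfold multiDeriv multiIndexList
  induction List.finRange d with
  | nil => rfl
  | cons i l ih => rw [List.flatMap_cons, listDeriv_append, h, List.foldr_cons, ih]

theorem length_multiIndexList (α : Fin d → ℕ) : (multiIndexList α).length = ∑ i, α i := by
  simp [multiIndexList, List.length_flatMap, Fin.sum_univ_def]

/-- Partial derivatives of smooth functions commute, so only the multiplicities in a list matter.
This allows lists, suited to induction one derivative at a time, in place of multi-indices. -/
theorem exists_perm_multiIndexList (l : List (Fin d)) : ∃ α, l.Perm (multiIndexList α) := by
  refine ⟨fun i => l.count i, List.perm_iff_count.2 fun j => ?_⟩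
  rw [multiIndexList, List.count_flatMap]
  have : (List.map (List.count j ∘ fun i => List.replicate (List.count i l) i)
      (List.finRange d)).sum = ∑ i, if i = j then l.count j else 0 := by
    rw [Fin.sum_univ_def]
    congr 1
    refine List.map_congr_left fun i _ => ?_
    simp only [Function.comp_apply, List.count_replicate, beq_iff_eq]
    split_ifs with h <;> simp [h]
  rw [this]
  simp

/-- The smooth functions all of whose derivatives are integrable. -/
structure SmoothL1 (f : EuclideanSpace ℝ (Fin d) → ℂ) : Prop where
  contDiff : ContDiff ℝ (⊤ : ℕ∞) f
  integrable_listDeriv : ∀ l : List (Fin d), Integrable (listDeriv l f)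

namespace SmoothL1

variable {f g : EuclideanSpace ℝ (Fin d) → ℂ}

theorem integrable (hf : SmoothL1 f) : Integrable f := hf.integrable_listDeriv []

theorem listDeriv (hf : SmoothL1 f) (l : List (Fin d)) : SmoothL1 (listDeriv l f) :=
  ⟨hf.contDiff.listDeriv l, fun l' => by
    rw [← listDeriv_append]; exact hf.integrable_listDeriv _⟩

theorem partialDeriv (hf : SmoothL1 f) (i : Fin d) : SmoothL1 (partialDeriv i f) :=
  hf.listDeriv [i]

theorem sub (hf : SmoothL1 f) (hg : SmoothL1 g) : SmoothL1 (f - g) :=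
  ⟨hf.contDiff.sub hg.contDiff, fun l => by
    rw [listDeriv_sub hf.contDiff hg.contDiff]
    exact (hf.integrable_listDeriv l).sub (hg.integrable_listDeriv l)⟩

end SmoothL1

theorem mem_DL1Step_iff {ω : WeightFunction} {n : ℕ} {f : EuclideanSpace ℝ (Fin d) → ℂ} :
    f ∈ DL1Step d ω n ↔ SmoothL1 f ∧ DL1norm d ω n f < ∞ := by
  constructor
  · rintro ⟨h1, h2, h3⟩
    refine ⟨⟨h1, fun l => ?_⟩, h3⟩
    obtain ⟨α, hα⟩ := exists_perm_multiIndexList l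
    rw [listDeriv_perm h1 hα, ← multiDeriv_eq_listDeriv]
    exact h2 α
  · rintro ⟨h1, h3⟩
    exact ⟨h1.contDiff, fun α => by
      rw [multiDeriv_eq_listDeriv]; exact h1.integrable_listDeriv _, h3⟩

theorem DL1norm_le_iff {ω : WeightFunction} {n : ℕ} {f : EuclideanSpace ℝ (Fin d) → ℂ}
    (hf : ContDiff ℝ (⊤ : ℕ∞) f) {C : ℝ} (hC : 0 ≤ C) :
    DL1norm d ω n f ≤ ENNReal.ofReal C ↔ ∀ l : List (Fin d), eLpNorm (listDeriv l f) 1 volume ≤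
      ENNReal.ofReal (C * Real.exp (1 / (n : ℝ) * ω.psiStar (n * l.length))) := by
  have key : ∀ (a : ℝ≥0∞) (t : ℝ), a * ENNReal.ofReal (Real.exp (-t)) ≤ ENNReal.ofReal C ↔
      a ≤ ENNReal.ofReal (C * Real.exp t) := by
    intro a t
    rw [Real.exp_neg, ENNReal.ofReal_inv_of_pos (Real.exp_pos t), ← div_eq_mul_inv,
      ENNReal.div_le_iff (by simp [Real.exp_pos]) (by simp), ENNReal.ofReal_mul hC]
  rw [DL1norm, iSup_le_iff]
  simp only [key]
  constructor
  · intro h l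
    obtain ⟨α, hα⟩ := exists_perm_multiIndexList l
    rw [listDeriv_perm hf hα, ← multiDeriv_eq_listDeriv, hα.length_eq, length_multiIndexList]
    exact h α
  · intro h α
    rw [multiDeriv_eq_listDeriv, ← length_multiIndexList]
    exact h _

end ListDeriv

/-! ### Convolution of integrable functions with Schwartz functions. -/

section SchwartzConv

open scoped SchwartzMap LineDeriv

variable {d : ℕ}

/-- The convolution `f ⋆ g` of a scalar function with a vector valued one. -/
noncomputable def lconv {F : Type} [NormedAddCommGroup F] [NormedSpace ℝ F]
    [NormedSpace ℂ F]
    (f : EuclideanSpace ℝ (Fin d) → ℂ) (g : EuclideanSpace ℝ (Fin d) → F) :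
    EuclideanSpace ℝ (Fin d) → F :=
  convolution f g (ContinuousLinearMap.lsmul ℂ ℂ) volume

theorem lconv_apply {F : Type} [NormedAddCommGroup F] [NormedSpace ℝ F]
    [NormedSpace ℂ F]
    (f : EuclideanSpace ℝ (Fin d) → ℂ) (g : EuclideanSpace ℝ (Fin d) → F)
    (x : EuclideanSpace ℝ (Fin d)) : lconv f g x = ∫ t, f t • g (x - t) := rfl

theorem lconv_apply_swap {F : Type} [NormedAddCommGroup F] [NormedSpace ℝ F]
    [NormedSpace ℂ F]
    (f : EuclideanSpace ℝ (Fin d) → ℂ) (g : EuclideanSpace ℝ (Fin d) → F)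
    (x : EuclideanSpace ℝ (Fin d)) : lconv f g x = ∫ t, f (x - t) • g t :=
  convolution_lsmul_swap

theorem integrable_smul_schwartz {F : Type} [NormedAddCommGroup F] [NormedSpace ℝ F]
    [NormedSpace ℂ F] {f : EuclideanSpace ℝ (Fin d) → ℂ} (hf : Integrable f)
    (g : 𝓢(EuclideanSpace ℝ (Fin d), F)) (x : EuclideanSpace ℝ (Fin d)) :
    Integrable fun t => f t • g (x - t) :=
  hf.smul_bdd (SchwartzMap.seminorm ℝ 0 0 g)
    (g.continuous.comp (continuous_const.sub continuous_id)).aestronglyMeasurable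
    (Eventually.of_forall fun t => g.norm_le_seminorm ℝ (x - t))

theorem hasFDerivAt_lconv {F : Type} [NormedAddCommGroup F] [NormedSpace ℝ F] [NormedSpace ℂ F]
    [SMulCommClass ℝ ℂ F] [IsScalarTower ℝ ℂ F]
    {f : EuclideanSpace ℝ (Fin d) → ℂ} (hf : Integrable f)
    (g : 𝓢(EuclideanSpace ℝ (Fin d), F)) (x : EuclideanSpace ℝ (Fin d)) :
    HasFDerivAt (lconv f g) (lconv f (SchwartzMap.fderivCLM ℝ _ F g) x) x := by
  have hg' : ∀ z, HasFDerivAt g (SchwartzMap.fderivCLM ℝ _ F g z) z := fun z => by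
    rw [SchwartzMap.fderivCLM_apply]
    exact (g.differentiable z).hasFDerivAt
  refine hasFDerivAt_integral_of_dominated_of_fderiv_le (𝕜 := ℝ) (s := univ)
    (F := fun x t => f t • g (x - t))
    (F' := fun x t => f t • SchwartzMap.fderivCLM ℝ _ F g (x - t))
    (bound := fun t => ‖f t‖ * SchwartzMap.seminorm ℝ 0 0 (SchwartzMap.fderivCLM ℝ _ F g))
    univ_mem (Eventually.of_forall fun z => (integrable_smul_schwartz hf g z).aestronglyMeasurable)
    (integrable_smul_schwartz hf g x) (integrable_smul_schwartz hf _ x).aestronglyMeasurable ?_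
    (hf.norm.mul_const _) ?_
  · refine Eventually.of_forall fun t z _ => ?_
    rw [norm_smul]
    gcongr
    exact SchwartzMap.norm_le_seminorm ℝ _ _
  · refine Eventually.of_forall fun t z _ => ?_
    have h1 : HasFDerivAt (fun z => g (z - t)) (SchwartzMap.fderivCLM ℝ _ F g (z - t)) z := by
      simpa [Function.comp_def] using (hg' (z - t)).comp z ((hasFDerivAt_id z).sub_const t)
    exact h1.const_smul (f t)

/-- The target `F` varies in the induction because the derivative of `f ⋆ g` is the convolution of
`f` with the operator-valued Schwartz function `g'`. -/
theorem contDiff_lconv_nat {f : EuclideanSpace ℝ (Fin d) → ℂ} (hf : Integrable f) (n : ℕ) :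
    ∀ {F : Type} [NormedAddCommGroup F] [NormedSpace ℝ F] [NormedSpace ℂ F]
      [SMulCommClass ℝ ℂ F] [IsScalarTower ℝ ℂ F] (g : 𝓢(EuclideanSpace ℝ (Fin d), F)),
      ContDiff ℝ n (lconv f g) := by
  induction n with
  | zero =>
    intro F _ _ _ _ _ g
    exact contDiff_zero.2 (continuous_iff_continuousAt.2 fun x =>
      (hasFDerivAt_lconv hf g x).continuousAt)
  | succ n ih =>
    intro F _ _ _ _ _ g
    refine (contDiff_succ_iff_hasFDerivAt (n := n)).2
      ⟨_, ih (SchwartzMap.fderivCLM ℝ _ F g), fun x => hasFDerivAt_lconv hf g x⟩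

theorem contDiff_lconv {f : EuclideanSpace ℝ (Fin d) → ℂ} (hf : Integrable f)
    (g : 𝓢(EuclideanSpace ℝ (Fin d), ℂ)) : ContDiff ℝ (⊤ : ℕ∞) (lconv f g) :=
  contDiff_infty.2 fun n => contDiff_lconv_nat hf n g

theorem partialDeriv_schwartz (g : 𝓢(EuclideanSpace ℝ (Fin d), ℂ)) (i : Fin d) :
    partialDeriv i g = ⇑(∂_{EuclideanSpace.single i (1 : ℝ)} g : 𝓢(EuclideanSpace ℝ (Fin d), ℂ)) := by
  funext x
  rw [SchwartzMap.lineDerivOp_apply_eq_fderiv]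
  rfl

theorem partialDeriv_lconv {f : EuclideanSpace ℝ (Fin d) → ℂ} (hf : Integrable f)
    (g : 𝓢(EuclideanSpace ℝ (Fin d), ℂ)) (i : Fin d) :
    partialDeriv i (lconv f g) = lconv f (partialDeriv i g) := by
  funext x
  rw [partialDeriv, (hasFDerivAt_lconv hf g x).fderiv, lconv_apply,
    ContinuousLinearMap.integral_apply (integrable_smul_schwartz hf _ x)]
  rfl

theorem exists_schwartz_listDeriv (g : 𝓢(EuclideanSpace ℝ (Fin d), ℂ)) (l : List (Fin d)) :
    ∃ h : 𝓢(EuclideanSpace ℝ (Fin d), ℂ), listDeriv l g = h := by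
  induction l with
  | nil => exact ⟨g, rfl⟩
  | cons i l ih =>
    obtain ⟨h, hh⟩ := ih
    exact ⟨_, by rw [listDeriv_cons, hh, partialDeriv_schwartz]⟩

theorem listDeriv_lconv {f : EuclideanSpace ℝ (Fin d) → ℂ} (hf : Integrable f)
    (g : 𝓢(EuclideanSpace ℝ (Fin d), ℂ)) (l : List (Fin d)) :
    listDeriv l (lconv f g) = lconv f (listDeriv l g) := by
  induction l with
  | nil => rfl
  | cons i l ih =>
    obtain ⟨h, hh⟩ := exists_schwartz_listDeriv g l
    rw [listDeriv_cons, ih, listDeriv_cons, hh, partialDeriv_lconv hf]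

/-- Differentiation under the integral falls on `g`; integration by parts moves it to `f`, all
products involved being integrable. -/
theorem partialDeriv_lconv_left {f : EuclideanSpace ℝ (Fin d) → ℂ} (hf : SmoothL1 f)
    (g : 𝓢(EuclideanSpace ℝ (Fin d), ℂ)) (i : Fin d) :
    partialDeriv i (lconv f g) = lconv (partialDeriv i f) g := by
  rw [partialDeriv_lconv hf.integrable]
  funext x
  have hg : ∀ t, HasFDerivAt (fun t => g (x - t)) (-fderiv ℝ g (x - t)) t := fun t => by
    have := (g.differentiable (x - t)).hasFDerivAt.comp t ((hasFDerivAt_id t).const_sub x)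
    simpa [ContinuousLinearMap.comp_neg, Function.comp_def] using this
  have h1 : Integrable fun t => f t * partialDeriv i g (x - t) := by
    rw [partialDeriv_schwartz]
    exact integrable_smul_schwartz hf.integrable _ x
  have h := integral_mul_fderiv_eq_neg_fderiv_mul_of_integrable (μ := volume)
    (f := f) (g := fun t => g (x - t)) (v := EuclideanSpace.single i (1 : ℝ))
    (integrable_smul_schwartz (hf.partialDeriv i).integrable g x)
    (by
      simp only [(hg _).fderiv, neg_apply, mul_neg]
      exact h1.neg)
    (integrable_smul_schwartz hf.integrable g x)
    (fun t _ => hf.contDiff.differentiable (by simp) t)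
    (fun t _ => (hg t).differentiableAt)
  simp only [(hg _).fderiv, neg_apply, mul_neg, integral_neg, neg_inj] at h
  exact h

theorem listDeriv_lconv_left {f : EuclideanSpace ℝ (Fin d) → ℂ} (hf : SmoothL1 f)
    (g : 𝓢(EuclideanSpace ℝ (Fin d), ℂ)) (l : List (Fin d)) :
    listDeriv l (lconv f g) = lconv (listDeriv l f) g := by
  induction l with
  | nil => rfl
  | cons i l ih => rw [listDeriv_cons, ih, partialDeriv_lconv_left (hf.listDeriv l)]; rfl

theorem SmoothL1.lconv {f : EuclideanSpace ℝ (Fin d) → ℂ} (hf : SmoothL1 f)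
    (g : 𝓢(EuclideanSpace ℝ (Fin d), ℂ)) : SmoothL1 (lconv f g) :=
  ⟨contDiff_lconv hf.integrable g, fun l => by
    rw [listDeriv_lconv_left hf]
    exact (hf.integrable_listDeriv l).integrable_convolution _ g.integrable⟩

theorem eLpNorm_lconv_le {f g : EuclideanSpace ℝ (Fin d) → ℂ} (hf : Continuous f)
    (hg : Continuous g) :
    eLpNorm (lconv f g) 1 volume ≤ eLpNorm f 1 volume * eLpNorm g 1 volume := by
  simp only [eLpNorm_one_eq_lintegral_enorm]
  calc ∫⁻ x, ‖lconv f g x‖ₑ ≤ ∫⁻ x, ∫⁻ t, ‖f t‖ₑ * ‖g (x - t)‖ₑ := by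
        refine lintegral_mono fun x => (enorm_integral_le_lintegral_enorm _).trans_eq ?_
        simp [enorm_mul]
    _ = ∫⁻ t, ∫⁻ x, ‖f t‖ₑ * ‖g (x - t)‖ₑ := by
        refine lintegral_lintegral_swap (Measurable.aemeasurable ?_)
        exact ((hf.comp continuous_snd).enorm.measurable).mul
          ((hg.comp (continuous_fst.sub continuous_snd)).enorm.measurable)
    _ = ∫⁻ t, ‖f t‖ₑ * ∫⁻ x, ‖g x‖ₑ := by
        refine lintegral_congr fun t => ?_
        rw [lintegral_const_mul _ (Continuous.enorm (by fun_prop)).measurable, lintegral_sub_right_eq_self (fun x => ‖g x‖ₑ)]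
    _ = _ := lintegral_mul_const _ hf.enorm.measurable

theorem fderiv_apply_eq_sum_partialDeriv (f : EuclideanSpace ℝ (Fin d) → ℂ)
    (x y : EuclideanSpace ℝ (Fin d)) : fderiv ℝ f x y = ∑ i, (y i : ℂ) * partialDeriv i f x := by
  conv_lhs => rw [← (EuclideanSpace.basisFun (Fin d) ℝ).sum_repr y]
  simp [partialDeriv, map_sum]

/-- Translation estimate in `L¹`. -/
theorem lintegral_enorm_sub_translate_le {f : EuclideanSpace ℝ (Fin d) → ℂ}
    (hf : ContDiff ℝ (⊤ : ℕ∞) f) (y : EuclideanSpace ℝ (Fin d)) :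
    ∫⁻ x, ‖f x - f (x - y)‖ₑ ≤ ‖y‖ₑ * ∑ i, eLpNorm (partialDeriv i f) 1 volume := by
  have hcont : Continuous (fderiv ℝ f) := hf.continuous_fderiv (by simp)
  have hc : ∀ i, Continuous (partialDeriv i f) := fun i => (hf.partialDeriv i).continuous
  have hpt : ∀ x, ‖f x - f (x - y)‖ₑ ≤ ∫⁻ s in Ioc (0 : ℝ) 1, ‖fderiv ℝ f (x - s • y) y‖ₑ := by
    intro x
    have h1 : ∀ s : ℝ, HasDerivAt (fun s : ℝ => f (x - s • y)) (-(fderiv ℝ f (x - s • y) y)) s := by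
      intro s
      have h2 : HasDerivAt (fun s : ℝ => x - s • y) (-y) s := by
        simpa using ((hasDerivAt_id s).smul_const y).const_sub x
      simpa [Function.comp_def] using
        (hf.differentiable (by simp) (x - s • y)).hasFDerivAt.comp_hasDerivAt s h2
    have h3 : Continuous fun s : ℝ => -(fderiv ℝ f (x - s • y) y) := by fun_prop
    have h4 := intervalIntegral.integral_eq_sub_of_hasDerivAt (fun s _ => h1 s)
      (h3.intervalIntegrable 0 1)
    simp only [one_smul, zero_smul, sub_zero] at h4
    rw [← enorm_neg, neg_sub, ← h4, intervalIntegral.integral_of_le zero_le_one]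
    refine (enorm_integral_le_lintegral_enorm _).trans_eq ?_
    simp
  calc ∫⁻ x, ‖f x - f (x - y)‖ₑ
      ≤ ∫⁻ x, ∫⁻ s in Ioc (0 : ℝ) 1, ‖fderiv ℝ f (x - s • y) y‖ₑ := lintegral_mono hpt
    _ = ∫⁻ s in Ioc (0 : ℝ) 1, ∫⁻ x, ‖fderiv ℝ f (x - s • y) y‖ₑ := by
        refine lintegral_lintegral_swap (Measurable.aemeasurable ?_)
        exact (Continuous.enorm (by fun_prop)).measurable
    _ = ∫⁻ s in Ioc (0 : ℝ) 1, ∫⁻ x, ‖fderiv ℝ f x y‖ₑ := by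
        refine lintegral_congr fun s => ?_
        exact lintegral_sub_right_eq_self (fun x => ‖fderiv ℝ f x y‖ₑ) (s • y)
    _ = ∫⁻ x, ‖fderiv ℝ f x y‖ₑ := by simp
    _ ≤ ∫⁻ x, ∑ i, ‖y‖ₑ * ‖partialDeriv i f x‖ₑ := by
        refine lintegral_mono fun x => ?_
        rw [fderiv_apply_eq_sum_partialDeriv]
        refine (enorm_sum_le _ _).trans (Finset.sum_le_sum fun i _ => ?_)
        rw [enorm_mul]
        gcongr
        rw [enorm_le_iff_norm_le, Complex.norm_real]
        exact PiLp.norm_apply_le y i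
    _ = _ := by
        rw [lintegral_finsetSum _ fun i _ => ((hc i).enorm.measurable.const_mul _), Finset.mul_sum]
        refine Finset.sum_congr rfl fun i _ => ?_
        rw [lintegral_const_mul _ (hc i).enorm.measurable, eLpNorm_one_eq_lintegral_enorm]

/-- As `g` has integral one, `f - f ⋆ g` averages the differences `f - f(· - y)` against `g(y)`; the
translation estimate and Tonelli produce the first absolute moment of `g`. -/
theorem eLpNorm_sub_lconv_le {f : EuclideanSpace ℝ (Fin d) → ℂ} (hf : SmoothL1 f)
    {g : 𝓢(EuclideanSpace ℝ (Fin d), ℂ)} (hg : ∫ x, g x = 1) :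
    eLpNorm (f - lconv f g) 1 volume ≤
      (∫⁻ y, ‖y‖ₑ * ‖g y‖ₑ) * ∑ i, eLpNorm (partialDeriv i f) 1 volume := by
  have hfc := hf.contDiff.continuous
  have hgc := g.continuous
  rw [eLpNorm_one_eq_lintegral_enorm]
  have hpt : ∀ x, (f - lconv f g) x = ∫ y, (f x - f (x - y)) * g y := by
    intro x
    have h1 : Integrable fun y => f (x - y) * g y := by
      have := integrable_smul_schwartz hf.integrable g x
      have h2 := this.comp_sub_left x
      simpa using h2
    simp only [sub_mul]
    rw [integral_sub (g.integrable.const_mul _) h1, integral_const_mul, hg, mul_one, Pi.sub_apply,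
      lconv_apply_swap]
    rfl
  calc ∫⁻ x, ‖(f - lconv f g) x‖ₑ ≤ ∫⁻ x, ∫⁻ y, ‖f x - f (x - y)‖ₑ * ‖g y‖ₑ := by
        refine lintegral_mono fun x => ?_
        rw [hpt]
        refine (enorm_integral_le_lintegral_enorm _).trans_eq ?_
        simp [enorm_mul]
    _ = ∫⁻ y, ∫⁻ x, ‖f x - f (x - y)‖ₑ * ‖g y‖ₑ := by
        refine lintegral_lintegral_swap (Measurable.aemeasurable ?_)
        exact (Continuous.enorm (by fun_prop)).measurable.mul
          (Continuous.enorm (by fun_prop)).measurable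
    _ = ∫⁻ y, (∫⁻ x, ‖f x - f (x - y)‖ₑ) * ‖g y‖ₑ := by
        refine lintegral_congr fun y => lintegral_mul_const _ (Continuous.enorm ?_).measurable
        fun_prop
    _ ≤ ∫⁻ y, (‖y‖ₑ * ‖g y‖ₑ) * ∑ i, eLpNorm (partialDeriv i f) 1 volume := by
        refine lintegral_mono fun y => ?_
        rw [mul_right_comm]
        gcongr
        exact lintegral_enorm_sub_translate_le hf.contDiff y
    _ = _ := lintegral_mul_const _ (by fun_prop)

end SchwartzConv

/-! ### Kernels with compactly supported Fourier transform, and their dilations. -/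

section BandlimitedKernel

open scoped SchwartzMap LineDeriv FourierTransform

variable {d : ℕ}

theorem SchwartzMap.smoothL1 (g : 𝓢(EuclideanSpace ℝ (Fin d), ℂ)) : SmoothL1 g :=
  ⟨g.smooth ⊤, fun l => by
    obtain ⟨h, hh⟩ := exists_schwartz_listDeriv g l
    rw [hh]
    exact h.integrable⟩

theorem SchwartzMap.eLpNorm_one_lt_top (g : 𝓢(EuclideanSpace ℝ (Fin d), ℂ)) :
    eLpNorm g 1 volume < ∞ := (memLp_one_iff_integrable.2 g.integrable).2

theorem lintegral_enorm_mul_enorm_schwartz_lt_top (g : 𝓢(EuclideanSpace ℝ (Fin d), ℂ)) :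
    ∫⁻ y, ‖y‖ₑ * ‖g y‖ₑ < ∞ := by
  have h := (g.integrable_pow_mul volume 1).2
  rw [hasFiniteIntegral_iff_enorm] at h
  simpa [enorm_mul] using h

/-- A Schwartz function with compactly supported Fourier transform satisfies Bernstein's
inequalities in `L¹`. -/
theorem exists_bandlimited_kernel (d : ℕ) : ∃ g : 𝓢(EuclideanSpace ℝ (Fin d), ℂ),
    ∫ x, g x = 1 ∧ ∃ A : ℝ, 1 ≤ A ∧ ∀ l : List (Fin d),
      eLpNorm (listDeriv l g) 1 volume ≤ ENNReal.ofReal (A ^ l.length) * eLpNorm g 1 volume := by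
  have hbump : ∀ r : ℝ, 0 < r → ∃ χ : 𝓢(EuclideanSpace ℝ (Fin d), ℂ),
      (∀ x, ‖x‖ ≤ r → χ x = 1) ∧ ∀ x, 2 * r ≤ ‖x‖ → χ x = 0 := by
    intro r hr
    let f : ContDiffBump (0 : EuclideanSpace ℝ (Fin d)) := ⟨r, 2 * r, hr, by linarith⟩
    have h1 : HasCompactSupport fun x => ((f x : ℝ) : ℂ) :=
      f.hasCompactSupport.comp_left (g := fun t : ℝ => (t : ℂ)) rfl
    have h2 : ContDiff ℝ (⊤ : ℕ∞) fun x => ((f x : ℝ) : ℂ) :=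
      Complex.ofRealCLM.contDiff.comp f.contDiff
    refine ⟨h1.toSchwartzMap h2, fun x hx => ?_, fun x hx => ?_⟩
    · have := f.one_of_mem_closedBall (x := x) (by simpa using hx)
      simp [this]
    · have := f.zero_of_le_dist (x := x) (by simpa using hx)
      simp [this]
  -- `χ₂` equals one wherever `χ₁` is nonzero, so `χ₁ χ₂ = χ₁`; on the inverse Fourier side this
  -- reads `g ⋆ h = g`.
  obtain ⟨χ₁, h₁, h₁'⟩ := hbump 1 one_pos
  obtain ⟨χ₂, h₂, -⟩ := hbump 2 two_pos
  set g : 𝓢(EuclideanSpace ℝ (Fin d), ℂ) := 𝓕⁻ χ₁ with hg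
  set h : 𝓢(EuclideanSpace ℝ (Fin d), ℂ) := 𝓕⁻ χ₂ with hh
  have hgh : lconv g h = g := by
    have e : SchwartzMap.convolution (ContinuousLinearMap.lsmul ℂ ℂ) g h = g := by
      have e1 : 𝓕 (SchwartzMap.convolution (ContinuousLinearMap.lsmul ℂ ℂ) g h) = 𝓕 g := by
        rw [SchwartzMap.fourier_convolution, hg, hh]
        ext x
        simp only [FourierTransform.fourier_fourierInv_eq, SchwartzMap.pairing_apply_apply,
          ContinuousLinearMap.lsmul_apply, smul_eq_mul]
        rcases le_total ‖x‖ 2 with hx | hx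
        · rw [h₂ x hx, mul_one]
        · rw [h₁' x (by simpa using hx), zero_mul]
      simpa using congrArg (fun u => 𝓕⁻ u) e1
    funext x
    conv_rhs => rw [← e, SchwartzMap.convolution_apply]
    rfl
  refine ⟨g, ?_, ?_⟩
  · have e1 : 𝓕 g 0 = 1 := by
      rw [hg, FourierTransform.fourier_fourierInv_eq]
      exact h₁ 0 (by simp)
    rw [SchwartzMap.fourier_coe, Real.fourier_eq] at e1
    simpa using e1
  · set A : ℝ≥0∞ := ∑ i, eLpNorm (partialDeriv i h) 1 volume with hA
    have hAtop : A < ∞ := by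
      refine ENNReal.sum_lt_top.2 fun i _ => ?_
      rw [partialDeriv_schwartz]
      exact SchwartzMap.eLpNorm_one_lt_top _
    have hAle : A ≤ ENNReal.ofReal (max A.toReal 1) := by
      rw [← ENNReal.ofReal_toReal hAtop.ne]
      exact ENNReal.ofReal_le_ofReal (by simp)
    refine ⟨max A.toReal 1, le_max_right _ _, fun l => ?_⟩
    -- The reproducing identity passes to all derivatives of `g`, so each further derivative can be
    -- put on `h` and costs one factor `‖∂ᵢ h‖₁`.
    have key : lconv (listDeriv l g) h = listDeriv l g ∧ eLpNorm (listDeriv l g) 1 volume ≤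
        ENNReal.ofReal (max A.toReal 1 ^ l.length) * eLpNorm g 1 volume := by
      induction l with
      | nil => exact ⟨hgh, by simp [listDeriv_nil]⟩
      | cons i l ih =>
        obtain ⟨ih1, ih2⟩ := ih
        have hs := g.smoothL1.listDeriv l
        rw [listDeriv_cons]
        refine ⟨?_, ?_⟩
        · rw [← partialDeriv_lconv_left hs, ih1]
        · conv_lhs => rw [← ih1]
          rw [partialDeriv_lconv hs.integrable]
          refine (eLpNorm_lconv_le hs.contDiff.continuous
            (h.smoothL1.partialDeriv i).contDiff.continuous).trans ?_
          rw [List.length_cons, pow_succ, ENNReal.ofReal_mul (by positivity), mul_right_comm]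
          gcongr
          exact (Finset.single_le_sum (f := fun i => eLpNorm (partialDeriv i h) 1 volume)
            (fun _ _ => zero_le) (Finset.mem_univ i)).trans hAle
    exact key.2

theorem lintegral_comp_smul_euclideanSpace (f : EuclideanSpace ℝ (Fin d) → ℝ≥0∞) {ρ : ℝ}
    (hρ : 0 < ρ) : ENNReal.ofReal (ρ ^ d) * ∫⁻ x, f (ρ • x) = ∫⁻ x, f x := by
  have h := (Homeomorph.smulOfNeZero ρ hρ.ne').toMeasurableEquiv.measurableEmbedding.lintegral_map
    (μ := (volume : Measure (EuclideanSpace ℝ (Fin d)))) f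
  have h2 : Measure.map ((Homeomorph.smulOfNeZero ρ hρ.ne').toMeasurableEquiv)
      (volume : Measure (EuclideanSpace ℝ (Fin d))) = ENNReal.ofReal ((ρ ^ d)⁻¹) • volume := by
    have := Measure.map_addHaar_smul (volume : Measure (EuclideanSpace ℝ (Fin d))) hρ.ne'
    rw [finrank_euclideanSpace_fin, abs_of_pos (by positivity)] at this
    exact this
  rw [h2, lintegral_smul_measure] at h
  change _ = ∫⁻ x, f (ρ • x) at h
  rw [← h, smul_eq_mul, ← mul_assoc, ← ENNReal.ofReal_mul (by positivity),
    mul_inv_cancel₀ (by positivity), ENNReal.ofReal_one, one_mul]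

theorem listDeriv_comp_smul {f : EuclideanSpace ℝ (Fin d) → ℂ} (hf : ContDiff ℝ (⊤ : ℕ∞) f)
    (ρ : ℝ) (l : List (Fin d)) :
    listDeriv l (fun x => f (ρ • x)) = fun x => ((ρ ^ l.length : ℝ) : ℂ) * listDeriv l f (ρ • x) := by
  induction l with
  | nil => simp [listDeriv_nil]
  | cons i l ih =>
    rw [listDeriv_cons, ih, listDeriv_cons]
    funext x
    have h1 := ((hf.listDeriv l).differentiable (by simp) (ρ • x)).hasFDerivAt.comp x
      ((hasFDerivAt_id x).const_smul ρ)
    have h2 := (h1.const_mul ((ρ ^ l.length : ℝ) : ℂ)).fderiv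
    simp only [Function.comp_def] at h2
    rw [partialDeriv, h2]
    simp [partialDeriv, pow_succ, mul_assoc]

/-- Approximate identities with bounds for all derivatives. -/
theorem exists_kernel_family (d : ℕ) : ∃ A : ℝ, 1 ≤ A ∧ ∃ K : ℝ, 0 ≤ K ∧ ∃ M : ℝ, 0 ≤ M ∧
    ∀ ρ : ℝ, 0 < ρ → ∃ g : 𝓢(EuclideanSpace ℝ (Fin d), ℂ), ∫ x, g x = 1 ∧
      (∀ l : List (Fin d), eLpNorm (listDeriv l g) 1 volume ≤
        ENNReal.ofReal (K * (A * ρ) ^ l.length)) ∧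
      ∫⁻ y, ‖y‖ₑ * ‖g y‖ₑ ≤ ENNReal.ofReal (M / ρ) := by
  obtain ⟨g, hg, A, hA, hgA⟩ := exists_bandlimited_kernel d
  have hK := g.eLpNorm_one_lt_top
  have hM := lintegral_enorm_mul_enorm_schwartz_lt_top g
  refine ⟨A, hA, (eLpNorm g 1 volume).toReal, ENNReal.toReal_nonneg,
    (∫⁻ y, ‖y‖ₑ * ‖g y‖ₑ).toReal, ENNReal.toReal_nonneg, fun ρ hρ => ?_⟩
  -- The kernel is `ρ^d g(ρx)`: its integral stays one, each derivative costs `ρ`, and the first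
  -- moment scales like `1/ρ`.
  let e : EuclideanSpace ℝ (Fin d) ≃L[ℝ] EuclideanSpace ℝ (Fin d) :=
    ContinuousLinearEquiv.smulLeft (Units.mk0 ρ hρ.ne')
  let u : 𝓢(EuclideanSpace ℝ (Fin d), ℂ) := SchwartzMap.compCLMOfContinuousLinearEquiv ℂ e g
  have hu : ⇑u = fun x => g (ρ • x) := rfl
  have hv : ⇑(((ρ ^ d : ℝ) : ℂ) • u) = ((ρ ^ d : ℝ) : ℂ) • fun x => g (ρ • x) := rfl
  have hc : ‖((ρ ^ d : ℝ) : ℂ)‖ₑ = ENNReal.ofReal (ρ ^ d) := by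
    rw [← ofReal_norm, Complex.norm_real, Real.norm_of_nonneg (by positivity)]
  refine ⟨((ρ ^ d : ℝ) : ℂ) • u, ?_, fun l => ?_, ?_⟩
  · rw [hv]
    simp only [Pi.smul_apply, integral_smul]
    rw [Measure.integral_comp_smul, finrank_euclideanSpace_fin, hg,
      abs_of_pos (by positivity)]
    have : ((ρ ^ d : ℝ) : ℂ) ≠ 0 := by exact_mod_cast (pow_pos hρ d).ne'
    rw [smul_eq_mul, Complex.real_smul, mul_one, Complex.ofReal_inv, mul_inv_cancel₀ this]
  · rw [hv, listDeriv_smul (hu ▸ u.smooth ⊤), listDeriv_comp_smul (g.smooth ⊤),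
      eLpNorm_const_smul, hc, eLpNorm_one_eq_lintegral_enorm]
    simp only [enorm_mul]
    have hcont : Continuous (listDeriv l g) := ((g.smooth ⊤).listDeriv l).continuous
    rw [lintegral_const_mul _ (Continuous.enorm (by fun_prop)).measurable, mul_left_comm,
      lintegral_comp_smul_euclideanSpace (fun x => ‖listDeriv l g x‖ₑ) hρ,
      ← eLpNorm_one_eq_lintegral_enorm, ← ofReal_norm, Complex.norm_real,
      Real.norm_of_nonneg (by positivity)]
    refine (mul_le_mul_right (hgA l) _).trans_eq ?_
    rw [mul_pow, ENNReal.ofReal_mul ENNReal.toReal_nonneg, ENNReal.ofReal_toReal hK.ne,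
      ENNReal.ofReal_mul (by positivity)]
    ring
  · rw [hv]
    simp only [Pi.smul_apply, enorm_smul, hc]
    have h1 : ∀ y : EuclideanSpace ℝ (Fin d), ‖y‖ₑ * (ENNReal.ofReal (ρ ^ d) * ‖g (ρ • y)‖ₑ) =
        ENNReal.ofReal (1 / ρ) * (ENNReal.ofReal (ρ ^ d) * (‖ρ • y‖ₑ * ‖g (ρ • y)‖ₑ)) := by
      intro y
      have h2 : ENNReal.ofReal (1 / ρ) * ‖ρ • y‖ₑ = ‖y‖ₑ := by
        rw [enorm_smul, ← mul_assoc, ← ofReal_norm ρ, Real.norm_of_nonneg hρ.le,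
          ← ENNReal.ofReal_mul (by positivity), one_div_mul_cancel hρ.ne', ENNReal.ofReal_one,
          one_mul]
      rw [← h2]; ring
    have hgc := g.continuous
    simp only [h1]
    rw [lintegral_const_mul _ (by fun_prop), lintegral_const_mul _ (by fun_prop),
      lintegral_comp_smul_euclideanSpace (fun x => ‖x‖ₑ * ‖g x‖ₑ) hρ, div_eq_mul_one_div (∫⁻ y, ‖y‖ₑ * ‖g y‖ₑ).toReal,
      ENNReal.ofReal_mul ENNReal.toReal_nonneg, ENNReal.ofReal_toReal hM.ne, mul_comm]

end BandlimitedKernel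

/-! ### Iterates of `f ↦ f - f ⋆ g`. -/

section Smoothing

open scoped SchwartzMap

variable {d : ℕ}

/-- The operator `f ↦ f - f ⋆ g`. -/
noncomputable def subConv (g : 𝓢(EuclideanSpace ℝ (Fin d), ℂ))
    (f : EuclideanSpace ℝ (Fin d) → ℂ) : EuclideanSpace ℝ (Fin d) → ℂ :=
  f - lconv f g

variable {g : 𝓢(EuclideanSpace ℝ (Fin d), ℂ)} {f : EuclideanSpace ℝ (Fin d) → ℂ}

theorem SmoothL1.subConv (hf : SmoothL1 f) : SmoothL1 (subConv g f) := hf.sub (hf.lconv g)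

theorem SmoothL1.iterate_subConv (hf : SmoothL1 f) (N : ℕ) : SmoothL1 ((_root_.subConv g)^[N] f) := by
  induction N with
  | zero => exact hf
  | succ N ih => rw [Function.iterate_succ_apply']; exact ih.subConv

theorem listDeriv_subConv (hf : SmoothL1 f) (l : List (Fin d)) :
    listDeriv l (subConv g f) = subConv g (listDeriv l f) := by
  rw [subConv, listDeriv_sub hf.contDiff (hf.lconv g).contDiff, listDeriv_lconv_left hf]
  rfl

theorem eLpNorm_iterate_subConv_le {K : ℝ} (hK : 0 ≤ K)
    (hg : eLpNorm g 1 volume ≤ ENNReal.ofReal K) (hf : SmoothL1 f) (N : ℕ) :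
    eLpNorm ((subConv g)^[N] f) 1 volume ≤ ENNReal.ofReal ((1 + K) ^ N) * eLpNorm f 1 volume := by
  induction N with
  | zero => simp
  | succ N ih =>
    have hN := hf.iterate_subConv (g := g) N
    rw [Function.iterate_succ_apply']
    calc eLpNorm (subConv g ((subConv g)^[N] f)) 1 volume
        ≤ eLpNorm ((subConv g)^[N] f) 1 volume +
          eLpNorm ((subConv g)^[N] f) 1 volume * ENNReal.ofReal K := by
          refine (eLpNorm_sub_le hN.contDiff.continuous.aestronglyMeasurable
            (hN.lconv g).contDiff.continuous.aestronglyMeasurable le_rfl).trans ?_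
          gcongr
          refine (eLpNorm_lconv_le hN.contDiff.continuous g.continuous).trans ?_
          gcongr
      _ = ENNReal.ofReal (1 + K) * eLpNorm ((subConv g)^[N] f) 1 volume := by
          rw [ENNReal.ofReal_add zero_le_one hK, ENNReal.ofReal_one]; ring
      _ ≤ ENNReal.ofReal (1 + K) * (ENNReal.ofReal ((1 + K) ^ N) * eLpNorm f 1 volume) := by
          gcongr
      _ = _ := by
          rw [pow_succ', ENNReal.ofReal_mul (by positivity), mul_assoc]

/-- The error of the `N`-fold smoothing gains `N` powers of the scale. -/
theorem eLpNorm_listDeriv_iterate_subConv_le {M : ℝ} (hM : 0 ≤ M) (hg : ∫ x, g x = 1)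
    (hgM : ∫⁻ y, ‖y‖ₑ * ‖g y‖ₑ ≤ ENNReal.ofReal M) (hf : SmoothL1 f) {κ : ℝ≥0∞} (N : ℕ)
    (l : List (Fin d)) (h : ∀ l' : List (Fin d), l'.length = l.length + N →
      eLpNorm (listDeriv l' f) 1 volume ≤ κ) :
    eLpNorm (listDeriv l ((subConv g)^[N] f)) 1 volume ≤ ENNReal.ofReal ((d * M) ^ N) * κ := by
  induction N generalizing l with
  | zero => simpa using h l (by simp)
  | succ N ih =>
    have hN := hf.iterate_subConv (g := g) N
    rw [Function.iterate_succ_apply', listDeriv_subConv hN]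
    refine (eLpNorm_sub_lconv_le (hN.listDeriv l) hg).trans ?_
    calc _ ≤ ENNReal.ofReal M * ∑ _i : Fin d, ENNReal.ofReal ((d * M) ^ N) * κ := by
          gcongr with i
          -- Removing one factor `subConv` costs one more derivative, so `l` grows as `N` falls; the
          -- `d` coordinates produce the factor `d`.
          rw [← listDeriv_cons]
          exact ih (i :: l) fun l' hl' => h l' (by rw [hl', List.length_cons]; ring)
      _ = _ := by
          rw [Finset.sum_const, Finset.card_univ, Fintype.card_fin, nsmul_eq_mul, ← mul_assoc,
            ← mul_assoc, pow_succ', ENNReal.ofReal_mul (by positivity),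
            ENNReal.ofReal_mul (by positivity), ENNReal.ofReal_natCast]
          ring

/-- Bernstein type bounds for the `N`-fold smoothing. -/
theorem eLpNorm_listDeriv_sub_iterate_subConv_le {K a : ℝ} (hK : 0 ≤ K) (ha : 0 ≤ a)
    (hg : ∀ l : List (Fin d), eLpNorm (listDeriv l g) 1 volume ≤
      ENNReal.ofReal (K * a ^ l.length)) (hf : SmoothL1 f) (N : ℕ) (l : List (Fin d)) :
    eLpNorm (listDeriv l (f - (subConv g)^[N] f)) 1 volume ≤
      ENNReal.ofReal ((1 + K) ^ N * a ^ l.length) * eLpNorm f 1 volume := by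
  induction N with
  | zero =>
    rw [Function.iterate_zero, id, listDeriv_sub hf.contDiff hf.contDiff, sub_self]
    simp
  | succ N ih =>
    have hN := hf.iterate_subConv (g := g) N
    -- Telescoping. In the new term all derivatives fall on `g`, and the constants add up as `(1 +
    -- K)^N + (1 + K)^N K = (1 + K)^(N+1)`.
    have e : f - (subConv g)^[N + 1] f =
        (f - (subConv g)^[N] f) + lconv ((subConv g)^[N] f) g := by
      rw [Function.iterate_succ_apply', subConv]
      abel
    have hs := hf.sub hN
    rw [e, listDeriv_add hs.contDiff (hN.lconv g).contDiff]
    refine (eLpNorm_add_le (hs.listDeriv l).contDiff.continuous.aestronglyMeasurable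
      ((hN.lconv g).listDeriv l).contDiff.continuous.aestronglyMeasurable le_rfl).trans ?_
    rw [listDeriv_lconv hN.integrable]
    calc _ ≤ ENNReal.ofReal ((1 + K) ^ N * a ^ l.length) * eLpNorm f 1 volume +
          ENNReal.ofReal ((1 + K) ^ N) * eLpNorm f 1 volume *
            ENNReal.ofReal (K * a ^ l.length) := by
          gcongr
          refine (eLpNorm_lconv_le hN.contDiff.continuous
            (g.smoothL1.listDeriv l).contDiff.continuous).trans ?_
          gcongr
          · exact eLpNorm_iterate_subConv_le hK (by simpa [listDeriv_nil] using hg []) hf N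
          · exact hg l
      _ = _ := by
          rw [mul_right_comm, ← ENNReal.ofReal_mul (by positivity), ← add_mul,
            ← ENNReal.ofReal_add (by positivity) (by positivity)]
          congr 2
          ring

end Smoothing

/-! ### Unit balls of the steps and their decomposition. -/

section Decomposition

variable {d : ℕ}

/-- Every element of the unit ball of a step splits into a large smooth part and a small rough
part. -/
theorem exists_decomposition (d : ℕ) (ω : WeightFunction) {m : ℕ} (hm : 1 ≤ m) :
    ∃ a > 0, ∃ b > 0, ∃ C > 0, ∀ R > 0, ∀ f ∈ DL1Step d ω m, DL1norm d ω m f ≤ 1 →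
      ∃ f₁ ∈ DL1Step d ω 1, ∃ f₂ ∈ DL1Step d ω (2 * m), f = f₁ + f₂ ∧
        DL1norm d ω 1 f₁ ≤ ENNReal.ofReal (C * Real.exp (a * R)) ∧
        DL1norm d ω (2 * m) f₂ ≤ ENNReal.ofReal (C * Real.exp (-(b * R))) := by
  obtain ⟨A, hA, K, hK, M, hM, hker⟩ := exists_kernel_family d
  obtain ⟨a, ha, b, hb, C, hC, h⟩ := ω.exists_scale_and_order hm hA
    (by positivity : 0 ≤ d * M) (by linarith : 1 ≤ 1 + K) zero_le_one
  refine ⟨a, ha, b, hb, C, hC, fun R hR f hf hf1 => ?_⟩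
  obtain ⟨ρ, hρ, N, h₁, h₂⟩ := h R hR
  obtain ⟨g, hg, hgK, hgM⟩ := hker ρ hρ
  obtain ⟨hs, -⟩ := mem_DL1Step_iff.1 hf
  have hbd := (DL1norm_le_iff hs.contDiff zero_le_one).1 (by simpa using hf1)
  have hN := hs.iterate_subConv (g := g) N
  -- The smooth part needs only the bound on `f` itself, with constant one because `ψ*(0) = 0`.
  have hf0 : eLpNorm f 1 volume ≤ 1 := by
    simpa [listDeriv_nil, ω.psiStar_zero] using hbd []
  have n₁ : DL1norm d ω 1 (f - (subConv g)^[N] f) ≤ ENNReal.ofReal (C * Real.exp (a * R)) := by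
    refine (DL1norm_le_iff (hs.sub hN).contDiff (by positivity)).2 fun l => ?_
    refine (eLpNorm_listDeriv_sub_iterate_subConv_le hK (by positivity) hgK hs N l).trans ?_
    refine (mul_le_mul_right hf0 _).trans ?_
    rw [mul_one]
    refine ENNReal.ofReal_le_ofReal ?_
    simpa using h₁ l.length
  have n₂ : DL1norm d ω (2 * m) ((subConv g)^[N] f) ≤
      ENNReal.ofReal (C * Real.exp (-(b * R))) := by
    refine (DL1norm_le_iff hN.contDiff (by positivity)).2 fun l => ?_
    refine (eLpNorm_listDeriv_iterate_subConv_le (by positivity) hg hgM hs N l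
      (κ := ENNReal.ofReal (Real.exp (1 / (m : ℝ) * ω.psiStar (m * (l.length + N : ℕ)))))
      fun l' hl' => ?_).trans ?_
    · simpa [hl'] using hbd l'
    · rw [← ENNReal.ofReal_mul (by positivity), ← mul_div_assoc]
      exact ENNReal.ofReal_le_ofReal (h₂ l.length)
  exact ⟨_, mem_DL1Step_iff.2 ⟨hs.sub hN, n₁.trans_lt ENNReal.ofReal_lt_top⟩, _,
    mem_DL1Step_iff.2 ⟨hN, n₂.trans_lt ENNReal.ofReal_lt_top⟩, by abel, n₁, n₂⟩

/-- The unit ball of the step `n + 1`. -/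
def DL1Ball (d : ℕ) (ω : WeightFunction) (n : ℕ) : Set (DL1 d ω) :=
  {φ | φ.toFun ∈ DL1Step d ω (n + 1) ∧ DL1norm d ω (n + 1) φ.toFun ≤ 1}

variable {ω : WeightFunction}

theorem monotone_DL1Ball : Monotone (DL1Ball d ω) := fun m n hmn _ hφ =>
  ⟨DL1Step_mono d ω (by omega) (by omega) hφ.1,
    (DL1norm_anti ω (by omega) (by omega) _).trans hφ.2⟩

theorem isVonNBounded_DL1Ball (n : ℕ) : Bornology.IsVonNBounded ℂ (DL1Ball d ω n) := by
  refine (DL1.withSeminorms d ω).isVonNBounded_iff_seminorm_bounded.2 fun p => ?_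
  obtain ⟨C, hC⟩ := p.2 (n + 1) (by omega)
  refine ⟨|C| + 1, by positivity, fun φ hφ => (hC φ hφ.1).trans_lt ?_⟩
  have h1 : (DL1norm d ω (n + 1) φ.toFun).toReal ≤ 1 := by
    simpa using ENNReal.toReal_mono ENNReal.one_ne_top hφ.2
  have h2 : 0 ≤ (DL1norm d ω (n + 1) φ.toFun).toReal := ENNReal.toReal_nonneg
  nlinarith [le_abs_self C, abs_nonneg C]

/-- Division by `c`. Any positive upper bound for the norm is allowed, which avoids separate
treatment of norm zero. -/
theorem exists_eq_smul_of_DL1norm_le {n : ℕ} {φ : DL1 d ω} (hφ : φ.toFun ∈ DL1Step d ω (n + 1))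
    {c : ℝ} (hc : 0 < c) (h : DL1norm d ω (n + 1) φ.toFun ≤ ENNReal.ofReal c) :
    ∃ χ ∈ DL1Ball d ω n, φ = (c : ℂ) • χ := by
  have hc' : (c : ℂ) ≠ 0 := by exact_mod_cast hc.ne'
  refine ⟨(c : ℂ)⁻¹ • φ, ⟨(DL1Step d ω (n + 1)).smul_mem _ hφ, ?_⟩, (smul_inv_smul₀ hc' φ).symm⟩
  change DL1norm d ω (n + 1) ((c : ℂ)⁻¹ • φ.toFun) ≤ 1
  rw [DL1norm_smul ω _ hφ.1, ← Complex.ofReal_inv, ← ofReal_norm, Complex.norm_real,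
    Real.norm_of_nonneg (by positivity), ENNReal.ofReal_inv_of_pos hc]
  refine (mul_le_mul_right h _).trans_eq (ENNReal.inv_mul_cancel ?_ ENNReal.ofReal_ne_top)
  simpa using hc

theorem exists_mem_smul_DL1Ball (φ : DL1 d ω) :
    ∃ n, ∃ c : ℂ, ∃ χ ∈ DL1Ball d ω n, φ = c • χ := by
  obtain ⟨n, hn, hφ⟩ : ∃ n : ℕ, 1 ≤ n ∧ φ.toFun ∈ DL1Step d ω n := φ.2
  obtain ⟨n, rfl⟩ := Nat.exists_eq_add_of_le' hn
  have h : DL1norm d ω (n + 1) φ.toFun ≤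
      ENNReal.ofReal ((DL1norm d ω (n + 1) φ.toFun).toReal + 1) := by
    conv_lhs => rw [← ENNReal.ofReal_toReal hφ.2.2.ne]
    exact ENNReal.ofReal_le_ofReal (by linarith)
  obtain ⟨χ, hχ, e⟩ := exists_eq_smul_of_DL1norm_le hφ (by positivity) h
  exact ⟨n, _, χ, hχ, e⟩

theorem continuous_of_bddAbove_DL1Ball (p : Seminorm ℂ (DL1 d ω))
    (hp : ∀ n, BddAbove (p '' DL1Ball d ω n)) : Continuous p := by
  refine (DL1.withSeminorms d ω).continuous_seminorm ⟨p, fun n hn => ?_⟩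
  obtain ⟨n, rfl⟩ := Nat.exists_eq_add_of_le' hn
  obtain ⟨C, hC⟩ := hp n
  refine ⟨C, fun φ hφ => ?_⟩
  refine le_of_forall_pos_le_add fun ε hε => ?_
  have hC0 : 0 ≤ C := by
    have h0 : (0 : DL1 d ω) ∈ DL1Ball d ω n := by
      refine ⟨(DL1Step d ω (n + 1)).zero_mem, ?_⟩
      change DL1norm d ω (n + 1) 0 ≤ 1
      simp [DL1norm_zero]
    simpa using hC (mem_image_of_mem p h0)
  set t := (DL1norm d ω (n + 1) φ.toFun).toReal with ht
  have ht0 : 0 ≤ t := ENNReal.toReal_nonneg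
  -- The norm `t` may vanish, so one rescales by `t + δ` instead; this choice ensures `C * δ ≤ ε`.
  set δ := ε / (C + 1) with hδ
  have hδ0 : 0 < δ := by positivity
  have h : DL1norm d ω (n + 1) φ.toFun ≤ ENNReal.ofReal (t + δ) := by
    rw [← ENNReal.ofReal_toReal hφ.2.2.ne]
    exact ENNReal.ofReal_le_ofReal (by linarith)
  obtain ⟨χ, hχ, e⟩ := exists_eq_smul_of_DL1norm_le hφ (by positivity) h
  have h1 : p χ ≤ C := hC (mem_image_of_mem p hχ)
  have h2 : C * δ ≤ ε := by
    rw [hδ, mul_div_assoc', div_le_iff₀ (by positivity)]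
    nlinarith
  rw [e, map_smul_eq_mul, Complex.norm_real, Real.norm_of_nonneg (by positivity)]
  nlinarith

theorem exists_decomposition_DL1Ball (m : ℕ) : ∃ k ≥ m, ∃ a > 0, ∃ b > 0, ∃ C > 0, ∃ R₀ : ℝ,
    ∀ R ≥ R₀, ∀ φ ∈ DL1Ball d ω m, ∃ φ₁ ∈ DL1Ball d ω 0, ∃ φ₂ ∈ DL1Ball d ω k,
      φ = ((C * Real.exp (a * R) : ℝ) : ℂ) • φ₁ + ((C * Real.exp (-(b * R)) : ℝ) : ℂ) • φ₂ := by
  obtain ⟨a, ha, b, hb, C, hC, h⟩ := exists_decomposition d ω (Nat.succ_pos m)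
  -- `DL1Ball` is shifted by one: index `m` is step `m + 1`, whose rough part lies in step `2(m +
  -- 1)`, that is, index `2m + 1`. The threshold `1` only ensures `R > 0`.
  refine ⟨2 * m + 1, by omega, a, ha, b, hb, C, hC, 1, fun R hR φ hφ => ?_⟩
  obtain ⟨f₁, h₁, f₂, h₂, e, n₁, n₂⟩ := h R (by linarith) φ.toFun hφ.1 hφ.2
  obtain ⟨χ₁, hχ₁, e₁⟩ := exists_eq_smul_of_DL1norm_le (n := 0)
    (φ := (⟨f₁, 1, le_rfl, h₁⟩ : DL1Union d ω)) h₁ (by positivity) n₁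
  obtain ⟨χ₂, hχ₂, e₂⟩ := exists_eq_smul_of_DL1norm_le (n := 2 * m + 1)
    (φ := (⟨f₂, 2 * (m + 1), by omega, h₂⟩ : DL1Union d ω)) h₂ (by positivity) n₂
  refine ⟨χ₁, hχ₁, χ₂, hχ₂, ?_⟩
  rw [← e₁, ← e₂]
  exact Subtype.ext e

end Decomposition

theorem mainTheorem3 (d : ℕ) (ω : WeightFunction) :
    IsFrechetSpace (BoundedUltradistribution d ω) ∧
      SatisfiesUnderlineDN (BoundedUltradistribution d ω) :=
  ⟨isFrechetSpace_strongDual isVonNBounded_DL1Ball monotone_DL1Ball exists_mem_smul_DL1Ball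
      continuous_of_bddAbove_DL1Ball,
    satisfiesUnderlineDN_strongDual isVonNBounded_DL1Ball monotone_DL1Ball exists_mem_smul_DL1Ball
      continuous_of_bddAbove_DL1Ball exists_decomposition_DL1Ball⟩
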